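/- Let $D$ be a finite 2-in, 2-out digraph: a directed multigraph, with loops and parallel arcs allowed and all arcs distinguishable, in which every vertex has in-degree 2 and out-degree 2; $D$ need not be connected. Let $n$ be its number of vertices. A circuit of $D$ is a nonempty cyclic sequence of distinct arcs in which each arc ends where the next one starts. Let $r_k(D)$ be the number of partitions of the arc set of $D$ into $k$ circuits, let $r(D;x)=\sum_k r_k(D)x^k$, and let $m(D;x)=\frac{1}{x-1}\,r(D;x-1)$ be the Martin polynomial. An anti-circuit is a closed trail in the underlying undirected multigraph of $D$ whose (cyclically) consecutive arcs are traversed with opposite orientations. (a) (Martin) The arc set of $D$ has a unique decomposition into (arc sets of) anti-circuits. If $a(D)$ is the number of anti-circuits in it, then $$-2\,m(D;-1)=r(D;-2)=(-1)^{n+a(D)}\,2^{a(D)} .$$ (b) Let $C$ be an Euler circuit of $D$, that is, a circuit containing every arc, and let $H=H(C)$ be its interlace graph: the simple graph on the vertices of $D$ in which distinct $a,b$ are adjacent if and only if $C$ visits them in the cyclic order $\ldots a\ldots b\ldots a\ldots b\ldots$. Let $|H|=n$ be the number of vertices of $H$. For an edge $ab$ of a finite simple graph $G$, the pivot $G^{ab}$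 is obtained from $G$ by toggling the adjacency of every pair $xy$ of vertices different from $a,b$ such that $x$ and $y$ lie in different ones of the three classes "adjacent to $a$ alone", "adjacent to $b$ alone", "adjacent to both $a$ and $b$". The interlace polynomial $q_G\in\mathbb{Z}[x]$ is computed by the rules $q_{E_m}=x^m$ for the edgeless graph $E_m$ on $m$ vertices, and $q_G=q_{G-a}+q_{G^{ab}-b}$ for any edge $ab$ of $G$. For the interlace graph $H$ these rules determine exactly one polynomial $q_H$, whatever edges are chosen, and $$q_H(-1)=(-1)^{|H|}(-2)^k$$ for some nonnegative integer $k$. -/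

import Mathlib

open Polynomial

universe u

/-- A directed multigraph with vertex set `V` and arc set `E`; loops and parallel arcs are allowed,
and all arcs are distinguishable. -/
structure MultiDigraph (V : Type*) (E : Type*) where
  /-- the tail of an arc -/
  src : E → V
  /-- the head of an arc -/
  tgt : E → V

namespace MultiDigraph

/-- Every vertex has exactly two incoming and exactly two outgoing arcs (a loop counts as one of
each). -/
def TwoInTwoOut {V E : Type*} (D : MultiDigraph V E) : Prop :=
  ∀ v : V, {e : E | D.tgt e = v}.ncard = 2 ∧ {e : E | D.src e = v}.ncard = 2

/-- A (directed) circuit: a nonempty cyclic sequence of pairwise distinct arcs in which every arc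
ends where the next one starts. Vertices may be repeated. -/
def IsCircuit {V E : Type*} (D : MultiDigraph V E) (c : Cycle E) : Prop :=
  c ≠ Cycle.nil ∧ c.Nodup ∧ c.Chain (fun e f => D.tgt e = D.src f)

/-- An Euler circuit: a circuit that traverses every arc. -/
def IsEulerCircuit {V E : Type*} (D : MultiDigraph V E) (c : Cycle E) : Prop :=
  D.IsCircuit c ∧ ∀ e : E, e ∈ c

/-- A partition of the arc set into circuits. -/
def IsCircuitPartition {V E : Type*} (D : MultiDigraph V E) (P : Finset (Cycle E)) : Prop :=
  (∀ c ∈ P, D.IsCircuit c) ∧ ∀ e : E, ∃! c : Cycle E, c ∈ P ∧ e ∈ c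

/-- `r_k(D)`: the number of partitions of the arc set into `k` circuits. -/
noncomputable def circuitPartitionCount {V E : Type*} (D : MultiDigraph V E) (k : ℕ) : ℕ :=
  {P : Finset (Cycle E) | D.IsCircuitPartition P ∧ P.card = k}.ncard

/-- The circuit partition polynomial `r(D; x) = ∑ₖ r_k(D) x ^ k` of a digraph with finitely many
arcs. Circuits are nonempty, so `r_k(D) = 0` for `k` larger than the number of arcs. -/
noncomputable def circuitPartitionPoly {V E : Type*} (D : MultiDigraph V E) : ℤ[X] :=
  ∑ k ∈ Finset.range (Nat.card E + 1), C (D.circuitPartitionCount k : ℤ) * X ^ k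

/-- The Martin polynomial `m(D; x) = r(D; x - 1) / (x - 1)`, as a rational function. -/
noncomputable def martin {V E : Type*} (D : MultiDigraph V E) : RatFunc ℚ :=
  algebraMap ℚ[X] (RatFunc ℚ)
      ((D.circuitPartitionPoly.map (Int.castRingHom ℚ)).comp (X - 1)) /
    algebraMap ℚ[X] (RatFunc ℚ) (X - 1)

/-- The vertex where a traversal starts; `(e, true)` is the arc `e` traversed along its
orientation, `(e, false)` is `e` traversed against its orientation. -/
def stepStart {V E : Type*} (D : MultiDigraph V E) (s : E × Bool) : V :=
  if s.2 then D.src s.1 else D.tgt s.1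

/-- The vertex where a traversal ends. -/
def stepEnd {V E : Type*} (D : MultiDigraph V E) (s : E × Bool) : V :=
  if s.2 then D.tgt s.1 else D.src s.1

/-- `S` is the arc set of an anti-circuit: a closed trail of pairwise distinct arcs in the
underlying undirected graph, any two (cyclically) consecutive arcs of which are traversed with
opposite orientations. -/
def IsAntiCircuit {V E : Type*} (D : MultiDigraph V E) (S : Set E) : Prop :=
  ∃ c : Cycle (E × Bool), c ≠ Cycle.nil ∧ (c.map Prod.fst).Nodup ∧
    c.Chain (fun s t => D.stepEnd s = D.stepStart t ∧ s.2 ≠ t.2) ∧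
    S = {e : E | e ∈ c.map Prod.fst}

/-- A decomposition of the arc set into (arc sets of) anti-circuits. -/
def IsAntiCircuitDecomposition {V E : Type*} (D : MultiDigraph V E) (P : Set (Set E)) : Prop :=
  Setoid.IsPartition P ∧ ∀ S ∈ P, D.IsAntiCircuit S

/-- Starting from a suitable arc, the cyclic sequence `c` visits `a` and `b` in the order
`… a … b … a … b …`. -/
def Interlaced {V E : Type*} (D : MultiDigraph V E) (c : Cycle E) (a b : V) : Prop :=
  ∃ l : List E, (l : Cycle E) = c ∧ List.Sublist [a, b, a, b] (l.map D.src)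

/-- The interlace graph `H(c)`: distinct vertices are adjacent when they are interlaced in `c`. -/
def interlaceGraph {V E : Type*} (D : MultiDigraph V E) (c : Cycle E) : SimpleGraph V :=
  SimpleGraph.fromRel (D.Interlaced c)

end MultiDigraph

/-- The pair `x y` is toggled by the pivot of `G` on `a b`: both vertices are different from `a`
and `b`, each is adjacent to `a` or to `b`, and they lie in different ones of the three classes
"adjacent to `a` alone", "adjacent to `b` alone", "adjacent to both". -/
def SimpleGraph.PivotToggles {V : Type*} (G : SimpleGraph V) (a b x y : V) : Prop :=
  (x ≠ a ∧ x ≠ b ∧ y ≠ a ∧ y ≠ b) ∧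
    (G.Adj x a ∨ G.Adj x b) ∧ (G.Adj y a ∨ G.Adj y b) ∧
    ¬ ((G.Adj x a ↔ G.Adj y a) ∧ (G.Adj x b ↔ G.Adj y b))

/-- The pivot `G^{ab}`. -/
def SimpleGraph.pivot {V : Type*} (G : SimpleGraph V) (a b : V) : SimpleGraph V where
  Adj x y := Xor (G.Adj x y) (G.PivotToggles a b x y)
  symm := ⟨fun x y h => by
    have hs : G.PivotToggles a b x y ↔ G.PivotToggles a b y x := by
      unfold SimpleGraph.PivotToggles; tauto
    rw [G.adj_comm y x, ← hs]; exact h⟩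
  loopless := ⟨fun x h => by
    simp [SimpleGraph.PivotToggles, Xor] at h⟩

/-- `IsInterlacePolynomial G q`: `q` is a value of the interlace polynomial of the finite simple
graph `G` computed by the rules `q(Eₙ) = xⁿ` and `q(G) = q(G - a) + q(G^{ab} - b)` for an edge
`ab` of `G`. -/
inductive IsInterlacePolynomial : {V : Type u} → SimpleGraph V → ℤ[X] → Prop
  | edgeless {V : Type u} [Finite V] : IsInterlacePolynomial (⊥ : SimpleGraph V) (X ^ Nat.card V)
  | step {V : Type u} [Finite V] {G : SimpleGraph V} {a b : V} {p q : ℤ[X]} (hab : G.Adj a b)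
      (hp : IsInterlacePolynomial (G.induce {v | v ≠ a}) p)
      (hq : IsInterlacePolynomial ((G.pivot a b).induce {v | v ≠ b}) q) :
      IsInterlacePolynomial G (p + q)

/-!
# The Martin polynomial and the interlace polynomial at `-1`

**Martin's theorem.** A circuit partition is a permutation `σ` of the arcs for which every arc `e`
ends where `σ e` starts, and its circuits are the orbits of `σ`. As the number of arcs is even,
`sign σ = (-1) ^ c` for the number `c` of orbits, and `2 ^ c` counts the two-colourings of the arcs
that are invariant under `σ`. Hence `r(D; -2)` is the sum of `sign σ` over all pairs of a transition
system `σ` and a `σ`-invariant colouring `f`. If two arcs with a common head, or with a common tail,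
have the same colour, exchanging them in `σ` cancels the contribution of `f`
(`MultiDigraph.sum_sign_eq_zero`). The remaining colourings alternate along every anti-circuit;
there are `2 ^ a(D)` of them (`Equiv.Perm.card_alternates`). Each is invariant under exactly one
`σ` (`MultiDigraph.existsUnique_isTransition`), whose sign is `(-1) ^ (n + a(D))`
(`Equiv.Perm.sign_eq_mul_sign_alternate`). Anti-circuits are the orbits of the group generated by
the involutions "other arc with the same head" and "other arc with the same tail"
(`MultiDigraph.setOf_isAntiCircuit`), so they partition the arcs in a unique way.

**The interlace polynomial.** What is claimed of interlace graphs holds for every finite simple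
graph `G`. Let `A` be its adjacency matrix over the field with two elements. The recursion computes
`∑ S, (x - 1) ^ null A[S]` (`IsInterlacePolynomial.eq_nullityPoly`), since pivoting on an edge is a
Schur complement; this gives uniqueness. An alternating matrix has even rank, so at `x = -1` the
term of `S` is `(-1) ^ |S|` times the number of kernel vectors of `A[S]`. Summing over `S` first,
a vector `v` survives only if `A v + v = 1`, and then contributes `(-1) ^ |v|`. These `v` form a
coset of the kernel of `A + I`, and all have the same sign: the parity of `|v|` is that of
`|G| + null (A + I)`, by comparison of `A + I` with the alternating matrix `A + I + J` of the
complement (`SimpleGraph.nullity_compl_univ`).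
-/

/-! ### Orbits of a permutation -/

namespace Equiv.Perm

variable {α : Type*}

/-- The number of orbits of a permutation, fixed points included. -/
noncomputable def orbitCount (σ : Perm α) : ℕ :=
  Nat.card (Quotient (SameCycle.setoid σ))

theorem orbitCount_eq_card_add_card [Fintype α] [DecidableEq α] (σ : Perm α) :
    σ.orbitCount = σ.cycleFactorsFinset.card + σ.supportᶜ.card := by
  classical
  have hwd : ∀ a b : α, (SameCycle.setoid σ) a b →
      (if h : a ∈ σ.support then
          (Sum.inl ⟨σ.cycleOf a, cycleOf_mem_cycleFactorsFinset_iff.2 h⟩ :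
            {c // c ∈ σ.cycleFactorsFinset} ⊕ {c // c ∈ σ.supportᶜ})
        else Sum.inr ⟨a, Finset.mem_compl.2 h⟩) =
      (if h : b ∈ σ.support then
          Sum.inl ⟨σ.cycleOf b, cycleOf_mem_cycleFactorsFinset_iff.2 h⟩
        else Sum.inr ⟨b, Finset.mem_compl.2 h⟩) := by
    intro a b hab
    have hab : SameCycle σ a b := hab
    by_cases ha : a ∈ σ.support
    · have hb : b ∈ σ.support := by
        rw [mem_support] at ha ⊢
        exact fun h => ha (hab.apply_eq_self_iff.2 h)
      simp only [ha, hb, dif_pos, Sum.inl.injEq, Subtype.mk.injEq]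
      exact hab.cycleOf_eq
    · have haf : Function.IsFixedPt σ a := notMem_support.1 ha
      have : a = b := hab.eq_of_left haf
      subst this
      rfl
  have hbij : Function.Bijective (Quotient.lift _ hwd) := by
    constructor
    · rintro ⟨a⟩ ⟨b⟩ h
      apply Quotient.sound
      change (if h : a ∈ σ.support then _ else _) = (if h : b ∈ σ.support then _ else _) at h
      change SameCycle σ a b
      split_ifs at h with ha hb hb
      · simp only [Sum.inl.injEq, Subtype.mk.injEq] at h
        by_contra hn
        have h1 := congrArg (fun p : Perm α => p a) h
        simp only [cycleOf_apply_self] at h1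
        rw [cycleOf_apply_of_not_sameCycle (fun h' => hn h'.symm)] at h1
        exact mem_support.1 ha h1
      · simp only [Sum.inr.injEq, Subtype.mk.injEq] at h
        rw [h]
    · rintro (⟨c, hc⟩ | ⟨a, ha⟩)
      · obtain ⟨a, ha⟩ := (mem_cycleFactorsFinset_iff.1 hc).1.nonempty_support
        have hs : a ∈ σ.support := mem_cycleFactorsFinset_support_le hc ha
        refine ⟨Quotient.mk _ a, ?_⟩
        change (if h : a ∈ σ.support then _ else _) = _
        rw [dif_pos hs]
        simp only [Sum.inl.injEq, Subtype.mk.injEq]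
        exact (cycle_is_cycleOf ha hc).symm
      · refine ⟨Quotient.mk _ a, ?_⟩
        change (if h : a ∈ σ.support then _ else _) = _
        rw [dif_neg (Finset.mem_compl.1 ha)]
  rw [orbitCount, Nat.card_congr (Equiv.ofBijective _ hbij), Nat.card_sum,
    Nat.card_eq_fintype_card, Nat.card_eq_fintype_card, Fintype.card_coe, Fintype.card_coe]

theorem sign_eq_neg_one_pow_orbitCount [Fintype α] [DecidableEq α] (σ : Perm α) :
    sign σ = (-1) ^ (Fintype.card α + σ.orbitCount) := by
  rw [sign_of_cycleType, sum_cycleType, orbitCount_eq_card_add_card, cycleType_def,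
    Multiset.card_map, Finset.card_val]
  have h := Finset.card_add_card_compl σ.support
  rw [← h, show σ.support.card + σ.supportᶜ.card + (σ.cycleFactorsFinset.card + σ.supportᶜ.card) =
    σ.support.card + σ.cycleFactorsFinset.card + 2 * σ.supportᶜ.card by ring,
    pow_add _ _ (2 * _), pow_mul]
  simp

/-- A two-colouring is invariant under a permutation exactly when it is constant on orbits. -/
theorem card_invariant_eq_two_pow [Finite α] (σ : Perm α) :
    Nat.card {f : α → Bool // ∀ a, f (σ a) = f a} = 2 ^ σ.orbitCount := by
  have e : {f : α → Bool // ∀ a, f (σ a) = f a} ≃ (Quotient (SameCycle.setoid σ) → Bool) :=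
    { toFun := fun f => Quotient.lift f.1 (by
        rintro a b ⟨k, rfl⟩
        have hz : ∀ k : ℤ, ∀ a, f.1 ((σ ^ k) a) = f.1 a := by
          intro k
          induction k using Int.induction_on with
          | zero => simp
          | succ i ih => intro a; rw [zpow_add_one, mul_apply, ih, f.2]
          | pred i ih =>
            intro a
            rw [zpow_sub_one, mul_apply, ih, ← f.2 (σ⁻¹ a), ← mul_apply, mul_inv_cancel, one_apply]
        exact (hz k a).symm)
      invFun := fun g => ⟨fun a => g (Quotient.mk _ a), fun a =>
        congrArg g (Quotient.sound (show SameCycle σ (σ a) a from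
          sameCycle_apply_left.2 (SameCycle.refl σ a)))⟩
      left_inv := fun f => rfl
      right_inv := fun g => by
        funext q
        induction q using Quotient.inductionOn
        rfl }
  rw [Nat.card_congr e, Nat.card_fun, orbitCount]
  simp

end Equiv.Perm

/-! ### Cyclic sequences -/

namespace Cycle

variable {α : Type*}

theorem chain_iff_next [DecidableEq α] {r : α → α → Prop} {c : Cycle α} (hc : c.Nodup) :
    c.Chain r ↔ ∀ x (hx : x ∈ c), r x (c.next hc x hx) := by
  induction c using Quotient.inductionOn with | _ l
  change (l : Cycle α).Chain r ↔ ∀ x (hx : x ∈ l), r x (l.next x hx)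
  have hl : l.Nodup := hc
  rcases l with _ | ⟨a, l⟩
  · simp
  set L := a :: l with hL
  have hlen : L.length = l.length + 1 := rfl
  have hmap : (L : Cycle α) = ((List.range (l.length + 1) : List ℕ) : Cycle ℕ).map
      (fun i => L.getD i a) := by
    rw [Cycle.map_coe]
    congr 1
    apply List.ext_getElem
    · simp [hL]
    · intro i h1 h2
      rw [List.getElem_map, List.getElem_range, List.getD_eq_getElem _ _ h1]
  rw [hmap, Cycle.chain_map, Cycle.chain_range_succ]
  have hnext : ∀ i (hi : i < L.length), L.next L[i] (List.getElem_mem hi) =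
      L[(i + 1) % L.length]'(Nat.mod_lt _ (by omega)) := by
    intro i hi
    exact List.next_getElem L hl i hi
  have hD : ∀ i, i < L.length → ∀ h : i < L.length, L.getD i a = L[i] :=
    fun i _ h => List.getD_eq_getElem _ _ h
  constructor
  · rintro ⟨h0, h1⟩ x hx
    obtain ⟨i, hi, rfl⟩ := List.getElem_of_mem hx
    rw [hnext i hi]
    rcases Nat.lt_or_ge i l.length with h | h
    · have := h1 i h
      rw [hD i hi hi, hD (i + 1) (by omega) (by omega)] at this
      simpa [Nat.mod_eq_of_lt (show i + 1 < L.length by omega)] using this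
    · have hi' : i = l.length := by omega
      subst hi'
      rw [hD _ hi hi, hD 0 (by omega) (by omega)] at h0
      simpa [← hlen] using h0
  · intro h
    constructor
    · have := h _ (List.getElem_mem (show l.length < L.length by omega))
      rw [hnext _ (by omega)] at this
      rw [hD _ (by omega) (by omega), hD 0 (by omega) (by omega)]
      simpa [← hlen] using this
    · intro i hi
      have := h _ (List.getElem_mem (show i < L.length by omega))
      rw [hnext _ (by omega)] at this
      rw [hD _ (by omega) (by omega), hD (i + 1) (by omega) (by omega)]
      simpa [Nat.mod_eq_of_lt (show i + 1 < L.length by omega)] using this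

theorem Chain.next [DecidableEq α] {r : α → α → Prop} {c : Cycle α} (h : c.Chain r)
    (hc : c.Nodup) {x : α} (hx : x ∈ c) : r x (c.next hc x hx) :=
  (chain_iff_next hc).1 h x hx

/-- A cyclic sequence of distinct elements that follows a map is a periodic orbit of that map. -/
theorem eq_periodicOrbit {σ : α → α} {c : Cycle α} (hc : c.Nodup)
    (h : c.Chain (fun a b => σ a = b)) {e : α} (he : e ∈ c) :
    c = Function.periodicOrbit σ e := by
  classical
  have hnext : ∀ x (hx : x ∈ c), c.next hc x hx = σ x := fun x hx => (h.next hc hx).symm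
  induction c using Quotient.inductionOn with | _ l
  have hl : l.Nodup := hc
  change ∀ x (hx : x ∈ l), l.next x hx = σ x at hnext
  obtain ⟨i, hi, rfl⟩ := List.getElem_of_mem (show e ∈ l from he)
  have hn : 0 < l.length := by omega
  have hit : ∀ m, σ^[m] l[i] = l[(i + m) % l.length]'(Nat.mod_lt _ hn) := by
    intro m
    induction m with
    | zero => simp [Nat.mod_eq_of_lt hi]
    | succ m ih =>
      rw [Function.iterate_succ_apply', ih, ← hnext _ (List.getElem_mem _),
        List.next_getElem l hl]
      congr 1
      simp [← add_assoc]
  have hper : Function.minimalPeriod σ l[i] = l.length := by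
    apply le_antisymm
    · apply Function.IsPeriodicPt.minimalPeriod_le hn
      change σ^[l.length] l[i] = l[i]
      rw [hit]
      simp [Nat.mod_eq_of_lt hi]
    · have hp : 0 < Function.minimalPeriod σ l[i] := by
        apply Function.IsPeriodicPt.minimalPeriod_pos hn
        change σ^[l.length] l[i] = l[i]
        rw [hit]
        simp [Nat.mod_eq_of_lt hi]
      have h1 : σ^[Function.minimalPeriod σ l[i]] l[i] = l[i] :=
        Function.isPeriodicPt_minimalPeriod σ l[i]
      rw [hit, hl.getElem_inj_iff] at h1
      by_contra hlt
      push Not at hlt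
      set m := Function.minimalPeriod σ l[i]
      rcases Nat.lt_or_ge (i + m) l.length with h2 | h2
      · rw [Nat.mod_eq_of_lt h2] at h1; omega
      · rw [Nat.mod_eq_sub_mod h2, Nat.mod_eq_of_lt (by omega)] at h1; omega
  rw [Function.periodicOrbit_def, hper]
  change (l : Cycle α) = _
  rw [← (Cycle.coe_eq_coe.2 (List.IsRotated.forall l i) : ((l.rotate i : List α) : Cycle α) = l)]
  congr 1
  apply List.ext_getElem
  · simp
  · intro m h1 h2
    simp only [List.getElem_rotate, List.getElem_map, List.getElem_range, hit]
    congr 1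
    rw [add_comm]

end Cycle

/-! ### Circuit partitions as permutations of the arcs -/

namespace Equiv.Perm

variable {α : Type*} [Finite α]

theorem mem_periodicPts (σ : Perm α) (a : α) : a ∈ Function.periodicPts σ :=
  Function.Injective.mem_periodicPts σ.injective a

theorem mem_periodicOrbit_iff_sameCycle (σ : Perm α) {a b : α} :
    b ∈ Function.periodicOrbit σ a ↔ SameCycle σ a b := by
  rw [Function.mem_periodicOrbit_iff (σ.mem_periodicPts a)]
  constructor
  · rintro ⟨n, rfl⟩
    exact ⟨n, by rw [zpow_natCast, iterate_eq_pow]⟩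
  · intro h
    obtain ⟨n, hn⟩ := h.exists_nat_pow_eq
    exact ⟨n, by rw [iterate_eq_pow, hn]⟩

theorem periodicOrbit_chain (σ : Perm α) (a : α) :
    (Function.periodicOrbit σ a).Chain (fun x y => σ x = y) := by
  rw [Function.periodicOrbit_chain' _ (σ.mem_periodicPts a)]
  intro n
  rw [Function.iterate_succ_apply']

theorem periodicOrbit_ne_nil (σ : Perm α) (a : α) : Function.periodicOrbit σ a ≠ Cycle.nil := by
  rw [Ne, Function.periodicOrbit_eq_nil_iff_not_periodic_pt]
  exact not_not.2 (σ.mem_periodicPts a)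

theorem periodicOrbit_eq_iff_sameCycle (σ : Perm α) {a b : α} :
    Function.periodicOrbit σ a = Function.periodicOrbit σ b ↔ SameCycle σ a b := by
  constructor
  · intro h
    rw [← mem_periodicOrbit_iff_sameCycle, h, mem_periodicOrbit_iff_sameCycle]
  · intro h
    exact Cycle.eq_periodicOrbit Function.nodup_periodicOrbit (σ.periodicOrbit_chain a)
      (σ.mem_periodicOrbit_iff_sameCycle.2 h)

/-- The orbits of a permutation, as cyclic sequences; a fixed point gives a sequence of
length one. -/
noncomputable def orbitCycles (σ : Perm α) : Finset (Cycle α) :=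
  (Set.finite_range fun a => Function.periodicOrbit σ a).toFinset

theorem mem_orbitCycles {σ : Perm α} {c : Cycle α} :
    c ∈ σ.orbitCycles ↔ ∃ a, Function.periodicOrbit σ a = c := by
  simp [orbitCycles]

theorem card_orbitCycles (σ : Perm α) : σ.orbitCycles.card = σ.orbitCount := by
  rw [orbitCycles, ← Set.ncard_eq_toFinset_card _ (Set.finite_range _), orbitCount, ← Nat.card_coe_set_eq]
  refine Nat.card_congr (Equiv.ofBijective (Quotient.lift (s := SameCycle.setoid σ)
    (fun a => (⟨Function.periodicOrbit σ a, a, rfl⟩ :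
      Set.range fun a => Function.periodicOrbit σ a)) ?_) ⟨?_, ?_⟩).symm
  · intro a b h
    exact Subtype.ext (σ.periodicOrbit_eq_iff_sameCycle.2 h)
  · rintro ⟨a⟩ ⟨b⟩ h
    exact Quotient.sound (σ.periodicOrbit_eq_iff_sameCycle.1 (congrArg Subtype.val h))
  · rintro ⟨_, a, rfl⟩
    exact ⟨Quotient.mk _ a, rfl⟩

theorem orbitCycles_injective : Function.Injective (orbitCycles : Perm α → Finset (Cycle α)) := by
  classical
  intro σ τ h
  ext a
  have hm : Function.periodicOrbit σ a ∈ τ.orbitCycles := h ▸ mem_orbitCycles.2 ⟨a, rfl⟩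
  obtain ⟨b, hb⟩ := mem_orbitCycles.1 hm
  have ha := σ.mem_periodicOrbit_iff_sameCycle.2 (SameCycle.refl σ a)
  have h1 := (σ.periodicOrbit_chain a).next Function.nodup_periodicOrbit ha
  have h2 : (Function.periodicOrbit σ a).Chain (fun x y => τ x = y) :=
    hb ▸ τ.periodicOrbit_chain b
  exact h1.trans (h2.next Function.nodup_periodicOrbit ha).symm

end Equiv.Perm

namespace MultiDigraph

open Equiv.Perm

variable {V E : Type*} (D : MultiDigraph V E)

/-- A transition system: every arc `e` is followed by an arc `σ e` that starts where `e` ends. -/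
def IsTransition (σ : Equiv.Perm E) : Prop :=
  ∀ e, D.tgt e = D.src (σ e)

variable {D}

theorem IsTransition.isCircuitPartition [Finite E] {σ : Equiv.Perm E} (hσ : D.IsTransition σ) :
    D.IsCircuitPartition σ.orbitCycles := by
  constructor
  · intro c hc
    obtain ⟨a, rfl⟩ := mem_orbitCycles.1 hc
    refine ⟨σ.periodicOrbit_ne_nil a, Function.nodup_periodicOrbit, ?_⟩
    exact (σ.periodicOrbit_chain a).imp fun x y (hxy : σ x = y) => hxy ▸ hσ x
  · intro e
    refine ⟨Function.periodicOrbit σ e, ⟨mem_orbitCycles.2 ⟨e, rfl⟩,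
      σ.mem_periodicOrbit_iff_sameCycle.2 (SameCycle.refl σ e)⟩, ?_⟩
    rintro c ⟨hc, he⟩
    obtain ⟨a, rfl⟩ := mem_orbitCycles.1 hc
    exact σ.periodicOrbit_eq_iff_sameCycle.2 (σ.mem_periodicOrbit_iff_sameCycle.1 he)

theorem IsCircuitPartition.exists_isTransition [Finite E] {P : Finset (Cycle E)}
    (hP : D.IsCircuitPartition P) : ∃ σ : Equiv.Perm E, D.IsTransition σ ∧ σ.orbitCycles = P := by
  classical
  choose c hc huniq using fun e => hP.2 e
  have hnd : ∀ e, (c e).Nodup := fun e => (hP.1 _ (hc e).1).2.1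
  -- the successor of `e` is the next arc on the circuit of `P` through `e`
  let s : E → E := fun e => (c e).next (hnd e) e (hc e).2
  have hs : ∀ d (hd : d ∈ P) e (he : e ∈ d), s e = d.next (hP.1 d hd).2.1 e he := by
    intro d hd e he
    obtain rfl := huniq e d ⟨hd, he⟩
    rfl
  have hsurj : Function.Surjective s := by
    intro e
    have hp := (c e).prev_mem (hnd e) e (hc e).2
    exact ⟨_, by rw [hs _ (hc e).1 _ hp, Cycle.next_prev]⟩
  let σ : Equiv.Perm E := Equiv.ofBijective s (Finite.injective_iff_bijective.1
    (Finite.injective_iff_surjective.2 hsurj))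
  have horb : ∀ e, Function.periodicOrbit σ e = c e := fun e =>
    (Cycle.eq_periodicOrbit (hnd e) ((Cycle.chain_iff_next (hnd e)).2 fun x hx =>
      hs _ (hc e).1 x hx) (hc e).2).symm
  refine ⟨σ, fun e => ((hP.1 _ (hc e).1).2.2.next (hnd e) (hc e).2), ?_⟩
  ext d
  rw [mem_orbitCycles]
  constructor
  · rintro ⟨e, rfl⟩
    rw [horb]
    exact (hc e).1
  · intro hd
    obtain ⟨e, he⟩ : ∃ e, e ∈ d := by
      have hne := (hP.1 d hd).1
      induction d using Quotient.inductionOn with | _ l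
      exact List.exists_mem_of_ne_nil l fun h => hne (by rw [h]; rfl)
    exact ⟨e, by rw [horb, huniq e d ⟨hd, he⟩]⟩

theorem setOf_isCircuitPartition_card_eq [Finite E] (k : ℕ) :
    {P : Finset (Cycle E) | D.IsCircuitPartition P ∧ P.card = k} =
      orbitCycles '' {σ : Equiv.Perm E | D.IsTransition σ ∧ σ.orbitCount = k} := by
  ext P
  constructor
  · rintro ⟨hP, rfl⟩
    obtain ⟨σ, hσ, rfl⟩ := hP.exists_isTransition
    exact ⟨σ, ⟨hσ, σ.card_orbitCycles.symm⟩, rfl⟩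
  · rintro ⟨σ, ⟨hσ, rfl⟩, rfl⟩
    exact ⟨hσ.isCircuitPartition, σ.card_orbitCycles⟩

open Classical in
theorem eval_circuitPartitionPoly [Fintype E] (x : ℤ) :
    D.circuitPartitionPoly.eval x =
      ∑ σ : Equiv.Perm E with D.IsTransition σ, x ^ σ.orbitCount := by
  have hk : ∀ k, D.circuitPartitionCount k =
      (({σ : Equiv.Perm E | D.IsTransition σ} : Finset _).filter (fun σ => σ.orbitCount = k)).card
      := by
    intro k
    rw [circuitPartitionCount, setOf_isCircuitPartition_card_eq,
      Set.ncard_image_of_injective _ orbitCycles_injective, Finset.filter_filter,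
      ← Set.ncard_coe_finset]
    simp
  rw [circuitPartitionPoly, eval_finsetSum]
  simp only [eval_mul, eval_C, eval_pow, eval_X, hk]
  rw [← Finset.sum_fiberwise_of_maps_to (g := fun σ : Equiv.Perm E => σ.orbitCount)
    (t := Finset.range (Nat.card E + 1))]
  · refine Finset.sum_congr rfl fun k _ => ?_
    rw [Finset.sum_congr rfl (g := fun _ => x ^ k)]
    · simp
    · intro σ hσ
      rw [(Finset.mem_filter.1 hσ).2]
  · intro σ _
    rw [Finset.mem_range, Nat.lt_succ_iff]
    exact Nat.card_le_card_of_surjective (Quotient.mk (SameCycle.setoid σ)) Quotient.mk_surjective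

end MultiDigraph

/-! ### Colourings that alternate along two fixed-point-free involutions -/

namespace Equiv.Perm

variable {α : Type*}

/-- A fixed-point-free involution, that is, a partition of `α` into pairs. -/
structure IsFreeInvolution (i : Perm α) : Prop where
  apply_apply : ∀ a, i (i a) = a
  apply_ne : ∀ a, i a ≠ a

theorem IsFreeInvolution.inv_eq {i : Perm α} (hi : i.IsFreeInvolution) : i⁻¹ = i := by
  rw [inv_eq_iff_mul_eq_one]
  ext a
  exact hi.apply_apply a

theorem IsFreeInvolution.sign_eq [Fintype α] [DecidableEq α] {i : Perm α}
    (hi : i.IsFreeInvolution) {n : ℕ} (hn : Fintype.card α = 2 * n) : sign i = (-1) ^ n := by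
  have h2 : i ^ 2 = 1 := by
    ext a
    exact hi.apply_apply a
  have h0 : Fintype.card (Function.fixedPoints i) = 0 := by
    rw [Fintype.card_eq_zero_iff]
    exact ⟨fun a => hi.apply_ne a.1 a.2⟩
  rw [sign_of_pow_two_eq_one h2, hn, h0]
  simp

/-- Along the alternating walk `e, i e, o (i e), …` the elements at even distance from `e` do not
include `i e`: the middle of a walk from `e` to `i e` of even length would be fixed by `i` or by
`o`. -/
theorem IsFreeInvolution.not_sameCycle_mul {i o : Perm α} (hi : i.IsFreeInvolution)
    (ho : o.IsFreeInvolution) (e : α) : ¬ SameCycle (o * i) e (i e) := by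
  rintro ⟨k, hk⟩
  have hconj : ∀ (m : ℤ) (a : α), i (((o * i) ^ m) a) = ((o * i) ^ (-m)) (i a) := by
    intro m a
    have h1 : i * (o * i) * i⁻¹ = (o * i)⁻¹ := by
      rw [mul_inv_rev, hi.inv_eq, ho.inv_eq, mul_assoc, mul_assoc]
      congr 1
      ext a
      simp [hi.apply_apply]
    have h2 : i * (o * i) ^ m * i⁻¹ = (o * i) ^ (-m) := by
      rw [zpow_neg, ← inv_zpow, ← h1, conj_zpow]
    rw [← h2]
    simp
  rcases Int.even_or_odd' k with ⟨m, rfl | rfl⟩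
  · apply hi.apply_ne (((o * i) ^ m) e)
    rw [hconj, ← hk, ← mul_apply, ← zpow_add]
    congr 2
    ring
  · apply ho.apply_ne (((o * i) ^ (m + 1)) e)
    have : ∀ a, o a = (o * i) (i a) := fun a => by simp [hi.apply_apply]
    rw [this, hconj, ← hk, ← mul_apply, ← mul_apply, ← zpow_one_add, ← zpow_add]
    congr 2
    ring

/-- A two-colouring that gives different colours to the two elements of every pair of `i` and of
every pair of `o`. -/
def Alternates (i o : Perm α) (f : α → Bool) : Prop :=
  (∀ a, f (i a) = !f a) ∧ ∀ a, f (o a) = !f a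

theorem exists_alternates [Finite α] {i o : Perm α} (hi : i.IsFreeInvolution)
    (ho : o.IsFreeInvolution) : ∃ f, Alternates i o f := by
  -- `N` numbers the orbits of `o * i`; `i` and `o` both exchange the orbit of `a` with another one
  let N : α → ℕ := fun a =>
    (Finite.equivFin (Quotient (SameCycle.setoid (o * i))) (Quotient.mk _ a)).val
  have hN : ∀ a b, N a = N b ↔ SameCycle (o * i) a b := by
    intro a b
    simp only [N, Fin.val_inj, EmbeddingLike.apply_eq_iff_eq]
    exact Quotient.eq (r := SameCycle.setoid (o * i))
  have hne : ∀ a, N a ≠ N (i a) := fun a h => hi.not_sameCycle_mul ho a ((hN _ _).1 h)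
  have hoi : ∀ a, N (o a) = N (i a) := by
    intro a
    refine ((hN _ _).2 ⟨1, ?_⟩).symm
    simp [hi.apply_apply]
  have hio : ∀ a, N (i (o a)) = N a := by
    intro a
    refine (hN _ _).2 ⟨1, ?_⟩
    simp [hi.apply_apply, ho.apply_apply]
  refine ⟨fun a => decide (N a < N (i a)), fun a => ?_, fun a => ?_⟩
  · have := hne a
    simp only [hi.apply_apply]
    by_cases h : N a < N (i a)
    · simp [h, h.le]
    · simp [h, show N (i a) < N a by omega]
  · have := hne a
    simp only [hoi, hio]
    by_cases h : N a < N (i a)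
    · simp [h, h.le]
    · simp [h, show N (i a) < N a by omega]

/-- The permutation that applies `i` to the elements of colour `true` and `o` to those of colour
`false`. Its orbits are the orbits of the group generated by `i` and `o`. -/
def alternate {i o : Perm α} (hi : i.IsFreeInvolution) (ho : o.IsFreeInvolution) {f : α → Bool}
    (hf : Alternates i o f) : Perm α where
  toFun a := bif f a then i a else o a
  invFun a := bif f a then o a else i a
  left_inv a := by
    cases h : f a
    · simp [h, hf.2, ho.apply_apply]
    · simp [h, hf.1, hi.apply_apply]
  right_inv a := by
    cases h : f a
    · simp [h, hf.1, hi.apply_apply]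
    · simp [h, hf.2, ho.apply_apply]

section alternate

variable {i o : Perm α} (hi : i.IsFreeInvolution) (ho : o.IsFreeInvolution) {f : α → Bool}
  (hf : Alternates i o f)

theorem alternate_apply_of_true {a : α} (h : f a = true) : alternate hi ho hf a = i a := by
  simp [alternate, h]

theorem alternate_apply_of_false {a : α} (h : f a = false) : alternate hi ho hf a = o a := by
  simp [alternate, h]

theorem apply_alternate (a : α) : f (alternate hi ho hf a) = !f a := by
  cases h : f a
  · rw [alternate_apply_of_false hi ho hf h, hf.2, h]
  · rw [alternate_apply_of_true hi ho hf h, hf.1, h]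

theorem alternate_apply_apply_left {a : α} (h : f a = false) :
    alternate hi ho hf (i a) = a := by
  rw [alternate_apply_of_true hi ho hf (by rw [hf.1, h]; rfl), hi.apply_apply]

theorem alternate_apply_apply_right {a : α} (h : f a = true) :
    alternate hi ho hf (o a) = a := by
  rw [alternate_apply_of_false hi ho hf (by rw [hf.2, h]; rfl), ho.apply_apply]

theorem sameCycle_alternate_left (a : α) : SameCycle (alternate hi ho hf) a (i a) := by
  cases h : f a
  · exact SameCycle.symm ⟨1, by rw [zpow_one, alternate_apply_apply_left hi ho hf h]⟩
  · exact ⟨1, by rw [zpow_one, alternate_apply_of_true hi ho hf h]⟩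

theorem sameCycle_alternate_right (a : α) : SameCycle (alternate hi ho hf) a (o a) := by
  cases h : f a
  · exact ⟨1, by rw [zpow_one, alternate_apply_of_false hi ho hf h]⟩
  · exact SameCycle.symm ⟨1, by rw [zpow_one, alternate_apply_apply_right hi ho hf h]⟩

/-- Two alternating colourings differ by a colouring that is constant on the orbits of `i` and
`o`. -/
theorem card_alternates [Finite α] :
    Nat.card {g : α → Bool // Alternates i o g} = 2 ^ (alternate hi ho hf).orbitCount := by
  rw [← card_invariant_eq_two_pow]
  refine Nat.card_congr
    { toFun := fun g => ⟨fun a => xor (g.1 a) (f a), fun a => ?_⟩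
      invFun := fun g => ⟨fun a => xor (g.1 a) (f a), fun a => ?_, fun a => ?_⟩
      left_inv := fun g => by ext a; simp
      right_inv := fun g => by ext a; simp }
  · cases h : f a
    · simp [alternate_apply_of_false hi ho hf h, g.2.2, hf.2, h]
    · simp [alternate_apply_of_true hi ho hf h, g.2.1, hf.1, h]
  · cases h : f a
    · have := g.2 (i a)
      rw [alternate_apply_apply_left hi ho hf h] at this
      simp [hf.1, h, this]
    · have := g.2 a
      rw [alternate_apply_of_true hi ho hf h] at this
      simp [hf.1, h, this]
  · cases h : f a
    · have := g.2 a
      rw [alternate_apply_of_false hi ho hf h] at this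
      simp [hf.2, h, this]
    · have := g.2 (o a)
      rw [alternate_apply_apply_right hi ho hf h] at this
      simp [hf.2, h, this]

/-- A permutation that carries the pairs of `i` to the pairs of `o` and preserves an alternating
colouring has a sign that does not depend on the permutation: if `A` is its restriction to the
elements of colour `false`, then it equals `A * o * A * alternate hi ho hf`. -/
theorem sign_eq_mul_sign_alternate [Fintype α] [DecidableEq α] {σ : Perm α}
    (hσ : ∀ a, σ (i a) = o (σ a)) (hfσ : ∀ a, f (σ a) = f a) :
    sign σ = sign o * sign (alternate hi ho hf) := by
  let A : Perm α := ofSubtype (σ.subtypePerm (p := fun a => f a = false) (fun a => by rw [hfσ]))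
  have hA0 : ∀ a, f a = false → A a = σ a := fun a h => by
    simp only [A]
    exact ofSubtype_apply_of_mem (p := fun a => f a = false) _ h
  have hA1 : ∀ a, f a = true → A a = a := fun a h => by
    simp only [A]
    exact ofSubtype_apply_of_not_mem _ (by simp [h])
  have hmul : σ = A * o * A * alternate hi ho hf := by
    ext a
    simp only [mul_apply]
    cases h : f a
    · have h' : f (o a) = true := by rw [hf.2, h]; rfl
      rw [alternate_apply_of_false hi ho hf h, hA1 _ h', ho.apply_apply, hA0 _ h]
    · have h' : f (i a) = false := by rw [hf.1, h]; rfl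
      rw [alternate_apply_of_true hi ho hf h, hA0 _ h', hσ, ho.apply_apply,
        hA1 _ (by rw [hfσ, h])]
  conv_lhs => rw [hmul]
  simp only [sign_mul]
  rw [mul_right_comm (sign A), Int.units_mul_self, one_mul]

end alternate

end Equiv.Perm

/-! ### Two-to-one maps -/

namespace Equiv.Perm

variable {α β : Type*}

/-- The involution `i` exchanges the two elements of every fibre of `g`. -/
structure IsFibreSwap (i : Perm α) (g : α → β) : Prop extends IsFreeInvolution i where
  eq_iff : ∀ a b, g b = g a ↔ b = a ∨ b = i a

theorem IsFibreSwap.map_apply {i : Perm α} {g : α → β} (hi : i.IsFibreSwap g) (a : α) :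
    g (i a) = g a :=
  (hi.eq_iff a (i a)).2 (Or.inr rfl)

theorem IsFibreSwap.map_swap [DecidableEq α] {i : Perm α} {g : α → β} (hi : i.IsFibreSwap g)
    (a b : α) : g (swap a (i a) b) = g b := by
  rw [swap_apply_def]
  split_ifs with h1 h2
  · rw [h1, hi.map_apply]
  · rw [h2, hi.map_apply]
  · rfl

theorem exists_isFibreSwap {g : α → β} (hg : ∀ b, {a | g a = b}.ncard = 2) :
    ∃ i : Perm α, i.IsFibreSwap g := by
  have hex : ∀ a, ∃ a', a' ≠ a ∧ ∀ b, g b = g a ↔ b = a ∨ b = a' := by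
    intro a
    obtain ⟨x, y, hxy, hs⟩ := Set.ncard_eq_two.1 (hg (g a))
    have hmem : ∀ b, g b = g a ↔ b = x ∨ b = y := fun b => by
      simpa using Set.ext_iff.1 hs b
    rcases (hmem a).1 rfl with h | h
    · exact ⟨y, by rw [h]; exact hxy.symm, by rw [h] at hmem ⊢; exact hmem⟩
    · refine ⟨x, by rw [h]; exact hxy, fun b => ?_⟩
      rw [hmem, h]
      exact or_comm
  choose i hne hi using hex
  have hinv : Function.Involutive i := by
    intro a
    have h1 : g (i a) = g a := (hi a (i a)).2 (Or.inr rfl)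
    rcases (hi (i a) a).1 h1.symm with h | h
    · exact absurd h.symm (hne a)
    · exact h.symm
  exact ⟨hinv.toPerm, ⟨⟨hinv, hne⟩, hi⟩⟩

theorem card_eq_two_mul_of_fibres [Finite α] [Finite β] {g : α → β}
    (hg : ∀ b, {a | g a = b}.ncard = 2) : Nat.card α = 2 * Nat.card β := by
  cases nonempty_fintype β
  rw [← Nat.card_congr (Equiv.sigmaFiberEquiv g), Nat.card_sigma]
  rw [Finset.sum_congr rfl (g := fun _ => 2) fun b _ => ?_]
  · simp [mul_comm]
  · exact (Nat.card_coe_set_eq _).trans (hg b)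

end Equiv.Perm

namespace MultiDigraph

open Equiv Equiv.Perm

variable {V E : Type*} {D : MultiDigraph V E} {i o : Equiv.Perm E}

/-! ### The signed count of transition systems -/

theorem IsTransition.apply_fibreSwap {σ : Equiv.Perm E} (hσ : D.IsTransition σ)
    (hi : i.IsFibreSwap D.tgt) (ho : o.IsFibreSwap D.src) (e : E) : σ (i e) = o (σ e) := by
  have h : D.src (σ (i e)) = D.src (σ e) := by rw [← hσ, ← hσ, hi.map_apply]
  exact ((ho.eq_iff _ _).1 h).resolve_left fun h => hi.apply_ne e (σ.injective h)

/-- An alternating colouring of the arcs is invariant under exactly one transition system. -/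
theorem existsUnique_isTransition [Finite E] (hi : i.IsFibreSwap D.tgt)
    (ho : o.IsFibreSwap D.src) (hsrc : Function.Surjective D.src) {f : E → Bool}
    (hf : Alternates i o f) :
    ∃! σ : Equiv.Perm E, D.IsTransition σ ∧ ∀ e, f (σ e) = f e := by
  have hex : ∀ e, ∃ e', D.tgt e = D.src e' ∧ f e' = f e := by
    intro e
    obtain ⟨e', he'⟩ := hsrc (D.tgt e)
    by_cases h : f e' = f e
    · exact ⟨e', he'.symm, h⟩
    · refine ⟨o e', by rw [ho.map_apply, he'], ?_⟩
      rw [hf.2]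
      cases h1 : f e' <;> cases h2 : f e <;> simp_all
  choose s hs hfs using hex
  have hinj : Function.Injective s := by
    intro a b hab
    have h : D.tgt b = D.tgt a := by rw [hs, hs, hab]
    refine ((hi.eq_iff _ _).1 h).elim Eq.symm fun h' => ?_
    have h1 : f a = f b := by rw [← hfs, hab, hfs]
    rw [h', hf.1] at h1
    simp at h1
  refine ⟨Equiv.ofBijective s (Finite.injective_iff_bijective.1 hinj), ⟨hs, hfs⟩, ?_⟩
  rintro τ ⟨hτ, hfτ⟩
  ext e
  have h : D.src (τ e) = D.src (s e) := by rw [← hτ, hs]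
  refine ((ho.eq_iff _ _).1 h).resolve_right fun h' => ?_
  have h1 := hfτ e
  rw [h', hf.2, hfs] at h1
  simp at h1

open Classical in
/-- If a colouring does not alternate, then exchanging two arcs of the same colour that have a
common head, or a common tail, reverses the sign of every transition system that preserves it. -/
theorem sum_sign_eq_zero [Fintype E] (hi : i.IsFibreSwap D.tgt) (ho : o.IsFibreSwap D.src)
    {f : E → Bool} (hf : ¬ Alternates i o f) :
    ∑ σ : Equiv.Perm E with D.IsTransition σ ∧ ∀ e, f (σ e) = f e, ((sign σ : ℤˣ) : ℤ) = 0 := by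
  have hswap : ∀ {j : Equiv.Perm E} {e : E}, f (j e) = f e → ∀ x, f (swap e (j e) x) = f x := by
    intro j e h x
    rw [swap_apply_def]
    split_ifs with h1 h2
    · rw [h1, h]
    · rw [h2, h]
    · rfl
  have hcase : (∃ e, f (i e) = f e) ∨ ∃ e, f (o e) = f e := by
    by_contra hn
    push Not at hn
    refine hf ⟨fun a => ?_, fun a => ?_⟩
    · have := hn.1 a
      cases h1 : f a <;> simp_all
    · have := hn.2 a
      cases h1 : f a <;> simp_all
  rcases hcase with ⟨e, he⟩ | ⟨e, he⟩
  · refine Finset.sum_involution (fun σ _ => σ * swap e (i e)) ?_ ?_ ?_ ?_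
    · intro σ _
      simp [sign_swap (hi.apply_ne e).symm]
    · intro σ _ _ h
      rw [mul_eq_left, swap_eq_one_iff] at h
      exact hi.apply_ne e h.symm
    · intro σ hσ
      rw [Finset.mem_filter] at hσ ⊢
      refine ⟨Finset.mem_univ _, fun x => ?_, fun x => ?_⟩
      · rw [mul_apply, ← hσ.2.1, hi.map_swap]
      · rw [mul_apply, hσ.2.2, hswap he]
    · intro σ _
      simp [mul_assoc]
  · refine Finset.sum_involution (fun σ _ => swap e (o e) * σ) ?_ ?_ ?_ ?_
    · intro σ _
      simp [sign_swap (ho.apply_ne e).symm]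
    · intro σ _ _ h
      rw [mul_eq_right, swap_eq_one_iff] at h
      exact ho.apply_ne e h.symm
    · intro σ hσ
      rw [Finset.mem_filter] at hσ ⊢
      refine ⟨Finset.mem_univ _, fun x => ?_, fun x => ?_⟩
      · rw [mul_apply, ho.map_swap, hσ.2.1]
      · rw [mul_apply, hswap he, hσ.2.2]
    · intro σ _
      simp [← mul_assoc]

theorem eval_circuitPartitionPoly_neg_two [Finite E] {n : ℕ} (hn : Nat.card E = 2 * n)
    (hi : i.IsFibreSwap D.tgt) (ho : o.IsFibreSwap D.src)
    (hsrc : Function.Surjective D.src) {f₀ : E → Bool} (hf₀ : Alternates i o f₀) :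
    D.circuitPartitionPoly.eval (-2) =
      (-1) ^ (n + (alternate hi.toIsFreeInvolution ho.toIsFreeInvolution hf₀).orbitCount) *
        2 ^ (alternate hi.toIsFreeInvolution ho.toIsFreeInvolution hf₀).orbitCount := by
  classical
  cases nonempty_fintype E
  set a := (alternate hi.toIsFreeInvolution ho.toIsFreeInvolution hf₀).orbitCount with ha
  have hn' : Fintype.card E = 2 * n := by rw [← hn, Nat.card_eq_fintype_card]
  have hcount : ∀ f (hf : Alternates i o f),
      (alternate hi.toIsFreeInvolution ho.toIsFreeInvolution hf).orbitCount = a := by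
    intro f hf
    apply Nat.pow_right_injective le_rfl
    change 2 ^ _ = 2 ^ _
    rw [ha, ← card_alternates, ← card_alternates]
  have hsign : ∀ (σ : Equiv.Perm E) (f : E → Bool), Alternates i o f → D.IsTransition σ →
      (∀ e, f (σ e) = f e) → sign σ = (-1) ^ (n + a) := by
    intro σ f hf hσ hfσ
    rw [sign_eq_mul_sign_alternate hi.toIsFreeInvolution ho.toIsFreeInvolution hf
      (hσ.apply_fibreSwap hi ho) hfσ, ho.sign_eq hn', sign_eq_neg_one_pow_orbitCount,
      hcount f hf, hn', pow_add, pow_add, pow_mul]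
    simp
  have hterm : ∀ σ : Equiv.Perm E, ((-2 : ℤ)) ^ σ.orbitCount =
      ∑ f : E → Bool with ∀ e, f (σ e) = f e, ((sign σ : ℤˣ) : ℤ) := by
    intro σ
    have hcard : ({f : E → Bool | ∀ e, f (σ e) = f e} : Finset _).card = 2 ^ σ.orbitCount := by
      rw [← card_invariant_eq_two_pow, Nat.card_eq_fintype_card, Fintype.card_subtype]
    rw [Finset.sum_const, hcard, sign_eq_neg_one_pow_orbitCount, hn', pow_add, pow_mul]
    rw [show (-2 : ℤ) = 2 * (-1) by norm_num, mul_pow]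
    simp
  have hinner : ∀ f : E → Bool,
      ∑ σ : Equiv.Perm E with D.IsTransition σ ∧ ∀ e, f (σ e) = f e, ((sign σ : ℤˣ) : ℤ) =
        if Alternates i o f then (-1) ^ (n + a) else 0 := by
    intro f
    split_ifs with hf
    · obtain ⟨σ, hσ, huniq⟩ := existsUnique_isTransition hi ho hsrc hf
      rw [Finset.sum_eq_single σ]
      · rw [hsign σ f hf hσ.1 hσ.2]
        simp
      · intro τ hτ hne
        exact absurd (huniq τ (Finset.mem_filter.1 hτ).2) hne
      · intro h
        exact absurd (Finset.mem_filter.2 ⟨Finset.mem_univ σ, hσ⟩) h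
    · exact sum_sign_eq_zero hi ho hf
  have hswap : ∑ σ : Equiv.Perm E with D.IsTransition σ,
      ∑ f : E → Bool with ∀ e, f (σ e) = f e, ((sign σ : ℤˣ) : ℤ) =
      ∑ f : E → Bool, ∑ σ : Equiv.Perm E with D.IsTransition σ ∧ ∀ e, f (σ e) = f e,
        ((sign σ : ℤˣ) : ℤ) := by
    apply Finset.sum_comm'
    simp
  rw [eval_circuitPartitionPoly, Finset.sum_congr rfl fun σ _ => hterm σ, hswap,
    Finset.sum_congr rfl fun f _ => hinner f, ← Finset.sum_filter, Finset.sum_const,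
    ← Fintype.card_subtype, ← Nat.card_eq_fintype_card,
    card_alternates hi.toIsFreeInvolution ho.toIsFreeInvolution hf₀, ← ha]
  simp [mul_comm]

/-! ### Anti-circuits -/

/-- The anti-circuits are the orbits of the group generated by "the other arc with the same head"
and "the other arc with the same tail". -/
theorem setOf_isAntiCircuit [Finite E] (hi : i.IsFibreSwap D.tgt) (ho : o.IsFibreSwap D.src)
    {f : E → Bool} (hf : Alternates i o f) :
    {S | D.IsAntiCircuit S} = (SameCycle.setoid
      (alternate hi.toIsFreeInvolution ho.toIsFreeInvolution hf)).classes := by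
  classical
  set θ := alternate hi.toIsFreeInvolution ho.toIsFreeInvolution hf with hθ
  ext S
  constructor
  · rintro ⟨c, hnil, hnd, hchain, rfl⟩
    have hinj : ∀ s ∈ c, ∀ t ∈ c, s.1 = t.1 → s = t := by
      induction c using Quotient.inductionOn with | _ l
      exact fun s hs t ht => List.inj_on_of_nodup_map (f := Prod.fst) hnd hs ht
    have hcnd : c.Nodup := by
      induction c using Quotient.inductionOn with | _ l
      exact List.Nodup.of_map Prod.fst hnd
    -- the next arc shares with `s.1` the end at which `s` arrives: its head if `s.2`, else its tail
    have hnext : ∀ s (hs : s ∈ c), (c.next hcnd s hs).1 = bif s.2 then i s.1 else o s.1 := by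
      intro s hs
      have hmem := c.next_mem hcnd s hs
      obtain ⟨h1, h2⟩ := hchain.next hcnd hs
      have hne : (c.next hcnd s hs).1 ≠ s.1 := fun h =>
        h2 (congrArg Prod.snd (hinj _ hmem _ hs h)).symm
      cases hb : s.2
      · have hb' : (c.next hcnd s hs).2 = true := by
          cases h : (c.next hcnd s hs).2
          · exact absurd (hb.trans h.symm) h2
          · rfl
        simp only [stepEnd, stepStart, hb, hb', if_true] at h1
        exact ((ho.eq_iff _ _).1 h1.symm).resolve_left hne
      · have hb' : (c.next hcnd s hs).2 = false := by
          cases h : (c.next hcnd s hs).2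
          · rfl
          · exact absurd (hb.trans h.symm) h2
        simp only [stepEnd, stepStart, hb, hb', if_true] at h1
        exact ((hi.eq_iff _ _).1 h1.symm).resolve_left hne
    obtain ⟨s₀, hs₀⟩ : ∃ s, s ∈ c := by
      induction c using Quotient.inductionOn with | _ l
      exact List.exists_mem_of_ne_nil l fun h => hnil (by rw [h]; rfl)
    have htrans : IsTrans (E × Bool) (fun s t => SameCycle θ s.1 t.1) :=
      ⟨fun _ _ _ h h' => h.trans h'⟩
    have hsame : ∀ s ∈ c, ∀ t ∈ c, SameCycle θ s.1 t.1 := by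
      rw [← Cycle.chain_iff_pairwise (r := fun s t : E × Bool => SameCycle θ s.1 t.1),
        Cycle.chain_iff_next hcnd]
      intro s hs
      rw [hnext s hs]
      cases s.2
      · exact sameCycle_alternate_right _ _ hf s.1
      · exact sameCycle_alternate_left _ _ hf s.1
    -- the neighbours of an arc on the anti-circuit are its images under `i` and `o`
    have hio : ∀ s ∈ c, (∃ t ∈ c, t.1 = i s.1) ∧ ∃ t ∈ c, t.1 = o s.1 := by
      intro s hs
      have h1 := hnext s hs
      have hpm := c.prev_mem hcnd s hs
      have h2 := hnext _ hpm
      have hor := (hchain.next hcnd hpm).2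
      simp only [Cycle.next_prev] at h2 hor
      have hb : (c.prev hcnd s hs).2 = !s.2 := by
        revert hor
        cases (c.prev hcnd s hs).2 <;> cases s.2 <;> simp
      rw [hb] at h2
      cases hs2 : s.2
      · rw [hs2] at h1 h2
        refine ⟨⟨_, hpm, ?_⟩, ⟨_, c.next_mem hcnd s hs, h1⟩⟩
        rw [h2]
        exact (hi.apply_apply _).symm
      · rw [hs2] at h1 h2
        refine ⟨⟨_, c.next_mem hcnd s hs, h1⟩, ⟨_, hpm, ?_⟩⟩
        rw [h2]
        exact (ho.apply_apply _).symm
    refine ⟨s₀.1, ?_⟩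
    ext e
    simp only [Set.mem_ofPred_eq, Cycle.mem_map]
    constructor
    · rintro ⟨s, hs, rfl⟩
      exact hsame s hs s₀ hs₀
    · intro he
      obtain ⟨k, rfl⟩ := (show SameCycle θ e s₀.1 from he).symm.exists_nat_pow_eq
      clear he
      induction k with
      | zero => exact ⟨s₀, hs₀, rfl⟩
      | succ k ih =>
        obtain ⟨s, hs, hse⟩ := ih
        rw [pow_succ', mul_apply, ← hse]
        cases h : f s.1
        · rw [hθ, alternate_apply_of_false _ _ hf h]
          exact (hio s hs).2
        · rw [hθ, alternate_apply_of_true _ _ hf h]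
          exact (hio s hs).1
  · rintro ⟨e, rfl⟩
    -- traverse the arcs of colour `true` forwards and the others backwards
    have hfst : ((Function.periodicOrbit θ e).map fun x => (x, f x)).map Prod.fst =
        Function.periodicOrbit θ e := by
      induction Function.periodicOrbit θ e using Quotient.inductionOn with | _ l
      change ((List.map Prod.fst (List.map (fun x => (x, f x)) l) : List E) : Cycle E) = l
      rw [List.map_map]
      exact congrArg _ (List.map_id l)
    refine ⟨(Function.periodicOrbit θ e).map fun x => (x, f x), ?_, ?_, ?_, ?_⟩
    · rw [Ne, Cycle.map_eq_nil]
      exact θ.periodicOrbit_ne_nil e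
    · rw [hfst]
      exact Function.nodup_periodicOrbit
    · rw [Cycle.chain_map]
      refine (θ.periodicOrbit_chain e).imp fun x y (hxy : θ x = y) => ?_
      subst hxy
      have hfx : f (θ x) = !f x := apply_alternate _ _ hf x
      refine ⟨?_, by simp [hfx]⟩
      cases h : f x
      · simp only [stepEnd, stepStart, hfx, h, Bool.not_false, if_true]
        rw [hθ, alternate_apply_of_false _ _ hf h, ho.map_apply]
        rfl
      · simp only [stepEnd, stepStart, hfx, h, Bool.not_true, if_true]
        rw [hθ, alternate_apply_of_true _ _ hf h, hi.map_apply]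
        rfl
    · ext x
      rw [hfst]
      simp only [Set.mem_ofPred_eq, mem_periodicOrbit_iff_sameCycle]
      exact sameCycle_comm

/-- The classes of an equivalence relation that are exactly the anti-circuits form the only
decomposition into anti-circuits. -/
theorem eq_of_isAntiCircuitDecomposition {r : Setoid E} (hr : {S | D.IsAntiCircuit S} = r.classes)
    {Q : Set (Set E)} (hQ : D.IsAntiCircuitDecomposition Q) : Q = r.classes := by
  have hsub : Q ⊆ r.classes := fun S hS => hr ▸ hQ.2 S hS
  refine hsub.antisymm fun S hS => ?_
  obtain ⟨e, he⟩ := Setoid.nonempty_of_mem_partition r.isPartition_classes hS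
  obtain ⟨T, ⟨hT, heT⟩, -⟩ := hQ.1.2 e
  obtain ⟨U, -, hU⟩ := r.isPartition_classes.2 e
  rw [hU S ⟨hS, he⟩, ← hU T ⟨hsub hT, heT⟩]
  exact hT

theorem ncard_classes_sameCycle {α : Type*} (σ : Equiv.Perm α) :
    (SameCycle.setoid σ).classes.ncard = σ.orbitCount := by
  rw [← Nat.card_coe_set_eq, orbitCount]
  exact Nat.card_congr (Setoid.quotientEquivClasses _).symm

/-! ### The Martin polynomial at `-1` -/

/-- The denominator of the Martin polynomial divides `X - 1`, so `-1` is not a pole and the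
evaluation there is an honest quotient. -/
theorem neg_two_mul_eval_martin (D : MultiDigraph V E) :
    -2 * D.martin.eval (RingHom.id ℚ) (-1) = ((D.circuitPartitionPoly.eval (-2) : ℤ) : ℚ) := by
  have hX : (X - 1 : ℚ[X]) ≠ 0 := X_sub_C_ne_zero 1
  have hX' : algebraMap ℚ[X] (RatFunc ℚ) (X - 1) ≠ 0 :=
    RatFunc.algebraMap_ne_zero hX
  have hden : (RatFunc.denom D.martin).eval₂ (RingHom.id ℚ) (-1) ≠ 0 := by
    intro h
    obtain ⟨q, hq⟩ := RatFunc.denom_div_dvd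
      ((D.circuitPartitionPoly.map (Int.castRingHom ℚ)).comp (X - 1)) (X - 1 : ℚ[X])
    have h2 := congrArg (Polynomial.eval₂ (RingHom.id ℚ) (-1)) hq
    rw [eval₂_mul] at h2
    erw [h] at h2
    norm_num at h2
  have hmul : D.martin * algebraMap ℚ[X] (RatFunc ℚ) (X - 1) = algebraMap ℚ[X] (RatFunc ℚ)
      ((D.circuitPartitionPoly.map (Int.castRingHom ℚ)).comp (X - 1)) :=
    div_mul_cancel₀ _ hX'
  have h1 := congrArg (RatFunc.eval (RingHom.id ℚ) (-1)) hmul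
  rw [RatFunc.eval_mul (hx := hden) (hy := by rw [RatFunc.denom_algebraMap]; simp), RatFunc.eval_algebraMap, RatFunc.eval_algebraMap] at h1
  have h3 : ((D.circuitPartitionPoly.eval (-2) : ℤ) : ℚ) =
      (D.circuitPartitionPoly.map (Int.castRingHom ℚ)).eval (-2) := by
    have := eval_intCast_map (Int.castRingHom ℚ) D.circuitPartitionPoly (-2)
    simpa using this.symm
  simp only [Algebra.algebraMap_self, RingHom.id_apply, eval₂_id, eval_comp, eval_sub, eval_X,
    eval_one] at h1
  rw [h3, ← show (-1 - 1 : ℚ) = -2 by norm_num, ← h1, mul_comm]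

end MultiDigraph

/-! ### The adjacency matrix over the field with two elements, and its pivots -/

namespace SimpleGraph

variable {V : Type*}

open Classical in
/-- The entries of the adjacency matrix over the field with two elements. -/
noncomputable def adjBit (G : SimpleGraph V) (v w : V) : ZMod 2 :=
  if G.Adj v w then 1 else 0

variable {G : SimpleGraph V} {a b : V}

theorem adjBit_congr {V W : Type*} {G : SimpleGraph V} {H : SimpleGraph W} {v v' : V} {w w' : W}
    (h : G.Adj v v' ↔ H.Adj w w') : G.adjBit v v' = H.adjBit w w' := by
  by_cases hG : G.Adj v v'
  · simp [adjBit, hG, h.1 hG]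
  · simp [adjBit, hG, mt h.2 hG]

theorem adjBit_comm (v w : V) : G.adjBit v w = G.adjBit w v :=
  adjBit_congr (G.adj_comm v w)

theorem adjBit_self (v : V) : G.adjBit v v = 0 := by
  simp [adjBit]

theorem adjBit_of_adj (h : G.Adj a b) : G.adjBit a b = 1 := by
  simp [adjBit, h]

theorem adjBit_pivot {v w : V} (hva : v ≠ a) (hvb : v ≠ b) (hwa : w ≠ a) (hwb : w ≠ b) :
    (G.pivot a b).adjBit v w =
      G.adjBit v w + G.adjBit v a * G.adjBit w b + G.adjBit v b * G.adjBit w a := by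
  have hadj : (G.pivot a b).Adj v w ↔ Xor (G.Adj v w) (G.PivotToggles a b v w) := Iff.rfl
  have h2 : (1 + 1 : ZMod 2) = 0 := rfl
  simp only [PivotToggles, Xor] at hadj
  by_cases h1 : G.Adj v w <;> by_cases h3 : G.Adj v a <;> by_cases h4 : G.Adj v b <;>
    by_cases h5 : G.Adj w a <;> by_cases h6 : G.Adj w b <;>
    simp only [h1, h3, h4, h5, h6, hva, hvb, hwa, hwb, ne_eq, not_true_eq_false,
      not_false_eq_true, and_true, and_false, or_true, or_false, iff_true, iff_false] at hadj <;>
    simp [adjBit, hadj, h1, h3, h4, h5, h6, h2]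

theorem adjBit_pivot_of_eq {v w : V} (h : v = a ∨ v = b ∨ w = a ∨ w = b) :
    (G.pivot a b).adjBit v w = G.adjBit v w := by
  have hadj : (G.pivot a b).Adj v w ↔ Xor (G.Adj v w) (G.PivotToggles a b v w) := Iff.rfl
  have ht : ¬ G.PivotToggles a b v w := by
    rintro ⟨⟨h1, h2, h3, h4⟩, -⟩
    tauto
  refine adjBit_congr ?_
  rw [hadj]
  simp [ht, Xor]

/-! ### Binary nullities of induced subgraphs -/

variable [Fintype V]

/-- The adjacency matrix over the field with two elements, as a linear map. -/
noncomputable def adjMap (G : SimpleGraph V) : (V → ZMod 2) →ₗ[ZMod 2] V → ZMod 2 :=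
  Matrix.mulVecLin (Matrix.of G.adjBit)

/-- The kernel of the adjacency matrix of the induced subgraph `G[S]` over the field with two
elements; its elements are extended by zero to all vertices. -/
noncomputable def inducedKernel (G : SimpleGraph V) (S : Finset V) :
    Submodule (ZMod 2) (V → ZMod 2) where
  carrier := {x | (∀ v ∉ S, x v = 0) ∧ ∀ v ∈ S, G.adjMap x v = 0}
  add_mem' := fun {x y} hx hy =>
    ⟨fun v hv => by simp [hx.1 v hv, hy.1 v hv], fun v hv => by simp [hx.2 v hv, hy.2 v hv]⟩
  zero_mem' := ⟨fun v _ => rfl, fun v _ => by simp⟩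
  smul_mem' := fun c x hx =>
    ⟨fun v hv => by simp [hx.1 v hv], fun v hv => by simp [hx.2 v hv]⟩

/-- The nullity of the adjacency matrix of the induced subgraph `G[S]` over the field with two
elements. -/
noncomputable def nullity (G : SimpleGraph V) (S : Finset V) : ℕ :=
  Module.finrank (ZMod 2) (G.inducedKernel S)

variable {S : Finset V}

theorem mem_inducedKernel {x : V → ZMod 2} :
    x ∈ G.inducedKernel S ↔ (∀ v ∉ S, x v = 0) ∧ ∀ v ∈ S, G.adjMap x v = 0 :=
  Iff.rfl

theorem adjMap_apply (x : V → ZMod 2) (v : V) : G.adjMap x v = ∑ w, G.adjBit v w * x w :=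
  rfl

theorem adjMap_single [DecidableEq V] (s : ZMod 2) (v : V) :
    G.adjMap (Pi.single a s) v = G.adjBit v a * s := by
  rw [adjMap_apply, Finset.sum_eq_single a]
  · simp
  · intro w _ hw
    simp [hw]
  · simp

theorem natCard_eq_two_pow (K : Submodule (ZMod 2) (V → ZMod 2)) :
    Nat.card K = 2 ^ Module.finrank (ZMod 2) K := by
  rw [Module.natCard_eq_pow_finrank (K := ZMod 2)]
  simp

theorem finrank_eq_of_equiv {W : Type*} [Fintype W] {K : Submodule (ZMod 2) (V → ZMod 2)}
    {L : Submodule (ZMod 2) (W → ZMod 2)} (e : K ≃ L) :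
    Module.finrank (ZMod 2) K = Module.finrank (ZMod 2) L := by
  apply Nat.pow_right_injective le_rfl
  change 2 ^ _ = 2 ^ _
  rw [← natCard_eq_two_pow, ← natCard_eq_two_pow, Nat.card_congr e]

theorem nullity_induce {s : Set V} [Fintype s] (S : Finset s) :
    (G.induce s).nullity S = G.nullity (S.map (Function.Embedding.subtype _)) := by
  classical
  have hmem : ∀ v (h : v ∈ s), v ∈ S.map (Function.Embedding.subtype _) ↔ ⟨v, h⟩ ∈ S := by
    intro v h
    simp [h]
  have hadj : ∀ x : V → ZMod 2, (∀ v ∉ s, x v = 0) → ∀ v : s,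
      (G.induce s).adjMap (fun w => x w) v = G.adjMap x v := by
    intro x hx v
    rw [adjMap_apply, adjMap_apply, ← Finset.sum_subset (Finset.subset_univ s.toFinset),
      ← Finset.sum_set_coe]
    · exact Finset.sum_congr rfl fun w _ => by
        rw [show (G.induce s).adjBit v w = G.adjBit v w from adjBit_congr Iff.rfl]
    · intro w _ hw
      rw [hx w (by simpa using hw), mul_zero]
  have hout : ∀ v ∉ s, v ∉ S.map (Function.Embedding.subtype _) := by
    intro v hv h
    obtain ⟨w, -, rfl⟩ := Finset.mem_map.1 h
    exact hv w.2
  refine finrank_eq_of_equiv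
    { toFun := fun x => ⟨fun v => if h : v ∈ s then x.1 ⟨v, h⟩ else 0, ?_⟩
      invFun := fun x => ⟨fun v => x.1 v, ?_⟩
      left_inv := fun x => by ext v; simp
      right_inv := fun x => ?_ }
  · have hz : ∀ v ∉ s, (if h : v ∈ s then x.1 ⟨v, h⟩ else 0) = 0 := fun v hv => dif_neg hv
    have hx := mem_inducedKernel.1 x.2
    refine mem_inducedKernel.2 ⟨fun v hv => ?_, fun v hv => ?_⟩
    · by_cases h : v ∈ s
      · simp only [h, dif_pos]
        exact hx.1 _ fun h' => hv ((hmem v h).2 h')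
      · simp [h]
    · obtain ⟨w, hw, rfl⟩ := Finset.mem_map.1 hv
      have := hadj _ hz w
      simp only [Subtype.coe_prop, dif_pos, Subtype.coe_eta] at this
      exact this.symm.trans (hx.2 w hw)
  · have hx := mem_inducedKernel.1 x.2
    refine mem_inducedKernel.2 ⟨fun v hv => ?_, fun v hv => ?_⟩
    · exact hx.1 v fun h => hv ((hmem v v.2).1 h)
    · rw [hadj x.1 (fun v hv => hx.1 v (hout v hv))]
      exact hx.2 v ((hmem v v.2).2 hv)
  · ext v
    by_cases h : v ∈ s
    · simp [h]
    · simp only [h, dif_neg, not_false_eq_true]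
      exact ((mem_inducedKernel.1 x.2).1 v (hout v h)).symm

theorem nullity_of_forall_not_adj (h : ∀ v ∈ S, ∀ w ∈ S, ¬ G.Adj v w) : G.nullity S = S.card := by
  classical
  apply Nat.pow_right_injective le_rfl
  change 2 ^ _ = 2 ^ _
  rw [nullity, ← natCard_eq_two_pow]
  have e : G.inducedKernel S ≃ (S → ZMod 2) :=
    { toFun := fun x v => x.1 v
      invFun := fun y => ⟨fun v => if h : v ∈ S then y ⟨v, h⟩ else 0, by
        refine mem_inducedKernel.2 ⟨fun v hv => dif_neg hv, fun v hv => ?_⟩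
        rw [adjMap_apply]
        refine Finset.sum_eq_zero fun w _ => ?_
        by_cases hw : w ∈ S
        · simp [adjBit, h v hv w hw]
        · simp [hw]⟩
      left_inv := fun x => by
        ext v
        by_cases hv : v ∈ S
        · simp [hv]
        · simp only [hv, dif_neg, not_false_eq_true]
          exact ((mem_inducedKernel.1 x.2).1 v hv).symm
      right_inv := fun y => by
        ext v
        simp }
  rw [Nat.card_congr e, Nat.card_fun]
  simp

/-! ### Nullities and pivots -/

theorem adjMap_pivot_of_eq {v : V} (h : v = a ∨ v = b) (x : V → ZMod 2) :
    (G.pivot a b).adjMap x v = G.adjMap x v := by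
  simp only [adjMap_apply]
  exact Finset.sum_congr rfl fun w _ => by rw [adjBit_pivot_of_eq (by tauto)]

/-- The adjacency matrix of the pivot is that of the Schur complement of the edge `a b`. -/
theorem adjMap_pivot {v : V} (hva : v ≠ a) (hvb : v ≠ b) {x : V → ZMod 2} (hxa : x a = 0)
    (hxb : x b = 0) :
    (G.pivot a b).adjMap x v =
      G.adjMap x v + G.adjBit v a * G.adjMap x b + G.adjBit v b * G.adjMap x a := by
  simp only [adjMap_apply, Finset.mul_sum, ← Finset.sum_add_distrib]
  refine Finset.sum_congr rfl fun w _ => ?_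
  by_cases hwa : w = a
  · simp [hwa, hxa]
  by_cases hwb : w = b
  · simp [hwb, hxb]
  rw [adjBit_pivot hva hvb hwa hwb, G.adjBit_comm b w, G.adjBit_comm a w]
  ring

theorem nullity_insert_insert [DecidableEq V] (hab : G.Adj a b) (ha : a ∉ S) (hb : b ∉ S) :
    G.nullity (insert a (insert b S)) = (G.pivot a b).nullity S := by
  have hne : a ≠ b := hab.ne
  have hab1 := adjBit_of_adj hab
  have hba1 := adjBit_of_adj hab.symm
  have hdec : ∀ (t : V → ZMod 2) (p q : ZMod 2) (v : V),
      G.adjMap (t + Pi.single a p + Pi.single b q) v =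
        G.adjMap t v + G.adjBit v a * p + G.adjBit v b * q := by
    intro t p q v
    simp [adjMap_single]
  have hself : ∀ p q : ZMod 2, p + q = 0 ↔ q = p := fun p q => by
    rw [CharTwo.add_eq_zero, eq_comm]
  -- the part of a kernel vector off `a` and `b` determines its values at `a` and `b`
  have key : ∀ (t : V → ZMod 2) (p q : ZMod 2), t a = 0 → t b = 0 →
      (t + Pi.single a p + Pi.single b q ∈ G.inducedKernel (insert a (insert b S)) ↔
        t ∈ (G.pivot a b).inducedKernel S ∧ p = G.adjMap t b ∧ q = G.adjMap t a) := by
    intro t p q hta htb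
    have hA := hdec t p q a
    have hB := hdec t p q b
    rw [adjBit_self, hab1, zero_mul, add_zero, one_mul] at hA
    rw [adjBit_self, hba1, zero_mul, add_zero, one_mul] at hB
    simp only [mem_inducedKernel, Finset.forall_mem_insert, hA, hB, hself]
    constructor
    · rintro ⟨h0, hq, hp, h⟩
      refine ⟨⟨fun v hv => ?_, fun v hv => ?_⟩, hp, hq⟩
      · by_cases hva : v = a
        · rw [hva, hta]
        by_cases hvb : v = b
        · rw [hvb, htb]
        simpa [hva, hvb] using h0 v (by simp [hva, hvb, hv])
      · rw [adjMap_pivot (ne_of_mem_of_not_mem hv ha) (ne_of_mem_of_not_mem hv hb) hta htb,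
          ← hp, ← hq, ← hdec, h v hv]
    · rintro ⟨⟨h0, h⟩, hp, hq⟩
      refine ⟨fun v hv => ?_, hq, hp, fun v hv => ?_⟩
      · simp only [Finset.mem_insert, not_or] at hv
        simp [hv.1, hv.2.1, h0 v hv.2.2]
      · rw [hdec, hp, hq, ← adjMap_pivot (ne_of_mem_of_not_mem hv ha)
          (ne_of_mem_of_not_mem hv hb) hta htb, h v hv]
  have hrec : ∀ x : V → ZMod 2,
      Function.update (Function.update x a 0) b 0 + Pi.single a (x a) + Pi.single b (x b) = x := by
    intro x
    ext v
    by_cases hva : v = a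
    · subst hva
      simp [hne]
    by_cases hvb : v = b
    · subst hvb
      simp [hva]
    simp [hva, hvb]
  have hza : ∀ x : V → ZMod 2, Function.update (Function.update x a 0) b 0 a = 0 := by
    intro x
    simp [hne]
  have hzb : ∀ x : V → ZMod 2, Function.update (Function.update x a 0) b 0 b = 0 := by
    intro x
    simp
  refine finrank_eq_of_equiv
    { toFun := fun x => ⟨Function.update (Function.update x.1 a 0) b 0, ?_⟩
      invFun := fun t => ⟨t.1 + Pi.single a (G.adjMap t.1 b) + Pi.single b (G.adjMap t.1 a), ?_⟩
      left_inv := fun x => ?_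
      right_inv := fun t => ?_ }
  · exact ((key _ (x.1 a) (x.1 b) (hza _) (hzb _)).1 (by rw [hrec]; exact x.2)).1
  · have h := mem_inducedKernel.1 t.2
    exact (key _ _ _ (h.1 a ha) (h.1 b hb)).2 ⟨t.2, rfl, rfl⟩
  · have h := (key _ (x.1 a) (x.1 b) (hza _) (hzb _)).1 (by rw [hrec]; exact x.2)
    ext1
    change _ + _ + _ = x.1
    rw [← h.2.1, ← h.2.2, hrec]
  · have h := mem_inducedKernel.1 t.2
    ext v
    by_cases hva : v = a
    · subst hva
      simp [hne, h.1 v ha]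
    by_cases hvb : v = b
    · subst hvb
      simp [h.1 v hb]
    simp [hva, hvb]

theorem nullity_pivot_of_mem [DecidableEq V] (hab : G.Adj a b) (ha : a ∈ S) (hb : b ∉ S) :
    (G.pivot a b).nullity S = G.nullity S := by
  have hne : a ≠ b := hab.ne
  have hba1 := adjBit_of_adj hab.symm
  have hupd : ∀ (x : V → ZMod 2) (p : ZMod 2) (v : V),
      G.adjMap (Function.update x a p) v = G.adjMap x v + G.adjBit v a * (x a + p) := by
    intro x p v
    have h : Function.update x a p = x + Pi.single a (x a + p) := by
      ext w
      by_cases hw : w = a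
      · subst hw
        simp [← add_assoc, CharTwo.add_self_eq_zero]
      · simp [hw]
    rw [h, map_add, Pi.add_apply, adjMap_single]
  have hupd' : ∀ (x : V → ZMod 2) (p : ZMod 2) (v : V), (G.pivot a b).adjMap
      (Function.update x a p) v = (G.pivot a b).adjMap x v + G.adjBit v a * (x a + p) := by
    intro x p v
    have h : Function.update x a p = x + Pi.single a (x a + p) := by
      ext w
      by_cases hw : w = a
      · subst hw
        simp [← add_assoc, CharTwo.add_self_eq_zero]
      · simp [hw]
    rw [h, map_add, Pi.add_apply, adjMap_single, adjBit_pivot_of_eq (by tauto)]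
  -- replacing `x a` by `(A x) b` absorbs the terms that the pivot adds to the rows other than `a`
  have hφ : ∀ x : V → ZMod 2, x b = 0 →
      (Function.update x a (G.adjMap x b) ∈ (G.pivot a b).inducedKernel S ↔
        x ∈ G.inducedKernel S) := by
    intro x hxb
    have hA : (G.pivot a b).adjMap (Function.update x a (G.adjMap x b)) a = G.adjMap x a := by
      rw [hupd', adjBit_self, zero_mul, add_zero, adjMap_pivot_of_eq (Or.inl rfl)]
    have hV : ∀ v, v ≠ a → v ≠ b →
        (G.pivot a b).adjMap (Function.update x a (G.adjMap x b)) v =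
          G.adjMap x v + G.adjBit v b * G.adjMap x a := by
      intro v hva hvb
      have h0a : Function.update x a 0 a = 0 := by simp
      have h0b : Function.update x a 0 b = 0 := by simp [hne.symm, hxb]
      have h := adjMap_pivot (G := G) hva hvb h0a h0b
      rw [hupd'] at h ⊢
      rw [hupd, hupd, hupd, adjBit_self, hba1, add_zero] at h
      have h2 : ∀ z : ZMod 2, z + z = 0 := CharTwo.add_self_eq_zero
      linear_combination h + h2 (G.adjBit v a * x a) + h2 (G.adjBit v a * G.adjMap x b)
    have hsupp : (∀ v ∉ S, Function.update x a (G.adjMap x b) v = 0) ↔ ∀ v ∉ S, x v = 0 := by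
      refine forall₂_congr fun v hv => ?_
      rw [Function.update_of_ne (ne_of_mem_of_not_mem ha hv).symm]
    rw [mem_inducedKernel, mem_inducedKernel, hsupp]
    refine and_congr_right fun _ => ⟨fun h v hv => ?_, fun h v hv => ?_⟩
    · have hxa : G.adjMap x a = 0 := by rw [← hA]; exact h a ha
      by_cases hva : v = a
      · rw [hva, hxa]
      · have := h v hv
        rwa [hV v hva (ne_of_mem_of_not_mem hv hb), hxa, mul_zero, add_zero] at this
    · by_cases hva : v = a
      · rw [hva, hA, h a ha]
      · rw [hV v hva (ne_of_mem_of_not_mem hv hb), h a ha, h v hv, mul_zero, add_zero]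
  have hinv : ∀ x : V → ZMod 2, Function.update (Function.update x a (G.adjMap x b)) a
      (G.adjMap (Function.update x a (G.adjMap x b)) b) = x := by
    intro x
    rw [hupd, hba1, one_mul, Function.update_idem, add_left_comm, CharTwo.add_self_eq_zero,
      add_zero, Function.update_eq_self]
  refine finrank_eq_of_equiv
    { toFun := fun x => ⟨Function.update x.1 a (G.adjMap x.1 b), ?_⟩
      invFun := fun x => ⟨Function.update x.1 a (G.adjMap x.1 b), ?_⟩
      left_inv := fun x => Subtype.ext (hinv x.1)
      right_inv := fun x => Subtype.ext (hinv x.1) }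
  · have hxb := (mem_inducedKernel.1 x.2).1 b hb
    rw [← hφ _ (by rw [Function.update_of_ne hne.symm, hxb]), hinv]
    exact x.2
  · exact (hφ _ ((mem_inducedKernel.1 x.2).1 b hb)).2 x.2

/-- An alternating matrix has even rank. -/
theorem even_nullity_add_card (G : SimpleGraph V) (S : Finset V) :
    Even (G.nullity S + S.card) := by
  classical
  induction hn : S.card using Nat.strong_induction_on generalizing G S with
  | _ n ih =>
    subst hn
    by_cases h : ∀ v ∈ S, ∀ w ∈ S, ¬ G.Adj v w
    · rw [nullity_of_forall_not_adj h]
      exact ⟨_, rfl⟩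
    · push Not at h
      obtain ⟨a, ha, b, hb, hab⟩ := h
      have hb' : b ∈ S.erase a := Finset.mem_erase.2 ⟨hab.ne.symm, hb⟩
      have hS : insert a (insert b ((S.erase a).erase b)) = S := by
        rw [Finset.insert_erase hb', Finset.insert_erase ha]
      have hc : ((S.erase a).erase b).card + 2 = S.card := by
        have h1 := Finset.card_erase_add_one hb'
        have h2 := Finset.card_erase_add_one ha
        omega
      have h1 := ih _ (by omega) (G.pivot a b) ((S.erase a).erase b) rfl
      rw [← nullity_insert_insert hab (by simp) (by simp), hS] at h1
      rw [← hc, ← add_assoc]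
      exact h1.add even_two

end SimpleGraph

/-! ### The vertex-nullity formula for the interlace polynomial -/

namespace SimpleGraph

/-- The sum of `(X - 1) ^ n(G[S])` over all sets `S` of vertices, where `n(G[S])` is the nullity
of the adjacency matrix of `G[S]` over the field with two elements. -/
noncomputable def nullityPoly {V : Type*} [Fintype V] (G : SimpleGraph V) : ℤ[X] :=
  ∑ S : Finset V, (X - 1) ^ G.nullity S

variable {V : Type*} [Fintype V] {G : SimpleGraph V} {a b : V}

theorem nullityPoly_bot : (⊥ : SimpleGraph V).nullityPoly = X ^ Nat.card V := by
  have h := Fintype.sum_pow_mul_eq_add_pow V (X - 1 : ℤ[X]) 1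
  rw [sub_add_cancel, ← Nat.card_eq_fintype_card] at h
  rw [← h]
  refine Finset.sum_congr rfl fun S _ => ?_
  rw [nullity_of_forall_not_adj (by simp), one_pow, mul_one]

theorem nullityPoly_induce_ne [DecidableEq V] (a : V) [Fintype {v | v ≠ a}] :
    (G.induce {v | v ≠ a}).nullityPoly = ∑ S : Finset V with a ∉ S, (X - 1) ^ G.nullity S := by
  refine Finset.sum_bij (fun S _ => S.map (Function.Embedding.subtype _)) ?_ ?_ ?_ ?_
  · intro S _
    simp
  · intro S _ T _ h
    exact Finset.map_injective _ h
  · intro T hT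
    have haT : a ∉ T := (Finset.mem_filter.1 hT).2
    refine ⟨T.subtype (· ∈ {v | v ≠ a}), Finset.mem_univ _, ?_⟩
    rw [Finset.subtype_map_of_mem]
    exact fun v hv => ne_of_mem_of_not_mem hv haT
  · intro S _
    rw [nullity_induce]

theorem nullityPoly_eq_add [DecidableEq V] [Fintype {v | v ≠ a}] [Fintype {v | v ≠ b}]
    (hab : G.Adj a b) : G.nullityPoly = (G.induce {v | v ≠ a}).nullityPoly +
      ((G.pivot a b).induce {v | v ≠ b}).nullityPoly := by
  have hne : a ≠ b := hab.ne
  rw [nullityPoly_induce_ne, nullityPoly_induce_ne, nullityPoly,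
    ← Finset.sum_filter_not_add_sum_filter Finset.univ (fun S : Finset V => a ∈ S)]
  congr 1
  rw [← Finset.sum_filter_not_add_sum_filter (Finset.univ.filter fun S : Finset V => a ∈ S)
      (fun S : Finset V => b ∈ S),
    ← Finset.sum_filter_not_add_sum_filter (Finset.univ.filter fun S : Finset V => b ∉ S)
      (fun S : Finset V => a ∈ S), add_comm]
  simp only [Finset.filter_filter]
  congr 1
  · -- sets that contain `a` and `b`
    refine Finset.sum_nbij' (fun S : Finset V => (S.erase a).erase b)
      (fun S => insert a (insert b S))
      ?_ ?_ ?_ ?_ ?_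
    · intro S _
      simp
    · intro S _
      simp
    · intro S hS
      simp only [Finset.mem_filter, Finset.mem_univ, true_and] at hS
      rw [Finset.insert_erase (Finset.mem_erase.2 ⟨hne.symm, hS.2⟩), Finset.insert_erase hS.1]
    · intro S hS
      simp only [Finset.mem_filter, Finset.mem_univ, true_and] at hS
      rw [Finset.erase_insert (by simp [hne, hS.2]), Finset.erase_insert hS.1]
    · intro S hS
      simp only [Finset.mem_filter, Finset.mem_univ, true_and] at hS
      rw [← nullity_insert_insert hab (by simp) (by simp),
        Finset.insert_erase (Finset.mem_erase.2 ⟨hne.symm, hS.2⟩), Finset.insert_erase hS.1]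
  · -- sets that contain `a` but not `b`
    refine Finset.sum_congr (Finset.filter_congr fun S _ => and_comm) fun S hS => ?_
    simp only [Finset.mem_filter, Finset.mem_univ, true_and] at hS
    rw [nullity_pivot_of_mem hab hS.2 hS.1]

end SimpleGraph

theorem IsInterlacePolynomial.eq_nullityPoly {V : Type u} {G : SimpleGraph V} {q : ℤ[X]}
    (h : IsInterlacePolynomial G q) : ∀ [Fintype V], q = G.nullityPoly := by
  induction h with
  | edgeless =>
    intro _
    exact SimpleGraph.nullityPoly_bot.symm
  | @step V _ G a b p q hab _ _ ihp ihq =>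
    intro _
    have := Fintype.ofFinite {v : V | v ≠ a}
    have := Fintype.ofFinite {v : V | v ≠ b}
    classical
    rw [SimpleGraph.nullityPoly_eq_add hab]
    exact congrArg₂ _ ihp ihq

theorem exists_isInterlacePolynomial {V : Type u} [Finite V] (G : SimpleGraph V) :
    ∃ q, IsInterlacePolynomial G q := by
  induction hn : Nat.card V using Nat.strong_induction_on generalizing V with
  | _ n ih =>
    subst hn
    by_cases h : ∃ a b, G.Adj a b
    · obtain ⟨a, b, hab⟩ := h
      have hlt : ∀ c : V, Nat.card {v | v ≠ c} < Nat.card V := fun c =>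
        Finite.card_subtype_lt (x := c) (by simp)
      obtain ⟨p, hp⟩ := ih _ (hlt a) (G.induce {v | v ≠ a}) rfl
      obtain ⟨q, hq⟩ := ih _ (hlt b) ((G.pivot a b).induce {v | v ≠ b}) rfl
      exact ⟨p + q, .step hab hp hq⟩
    · have hG : G = ⊥ := by
        ext v w
        simp only [SimpleGraph.bot_adj, iff_false]
        exact fun hvw => h ⟨v, w, hvw⟩
      subst hG
      exact ⟨_, .edgeless⟩

/-! ### The value at `-1` -/

namespace SimpleGraph

variable {V : Type*} [Fintype V] {G : SimpleGraph V}

theorem sum_mul_adjMap_comm (x y : V → ZMod 2) :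
    ∑ v, x v * G.adjMap y v = ∑ v, y v * G.adjMap x v := by
  simp only [adjMap_apply, Finset.mul_sum]
  rw [Finset.sum_comm]
  refine Finset.sum_congr rfl fun v _ => Finset.sum_congr rfl fun w _ => ?_
  rw [adjBit_comm]
  ring

/-- The bilinear form of an adjacency matrix is alternating. -/
theorem sum_mul_adjMap_self (x : V → ZMod 2) : ∑ v, x v * G.adjMap x v = 0 := by
  simp only [adjMap_apply, Finset.mul_sum]
  rw [← Fintype.sum_prod_type' (f := fun v w => x v * (G.adjBit v w * x w))]
  refine Finset.sum_involution (fun p _ => p.swap) ?_ ?_ ?_ ?_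
  · rintro ⟨v, w⟩ -
    simp only [Prod.fst_swap, Prod.snd_swap]
    rw [adjBit_comm w v, show x w * (G.adjBit v w * x v) = x v * (G.adjBit v w * x w) by ring]
    exact CharTwo.add_self_eq_zero _
  · rintro ⟨v, w⟩ - h heq
    obtain rfl : w = v := congrArg Prod.fst heq
    simp [adjBit_self] at h
  · simp
  · simp

/-- The matrix `A + I`, where `A` is the adjacency matrix over the field with two elements. -/
noncomputable def loopedMap (G : SimpleGraph V) : (V → ZMod 2) →ₗ[ZMod 2] V → ZMod 2 :=
  G.adjMap + LinearMap.id

theorem loopedMap_apply (x : V → ZMod 2) (v : V) : G.loopedMap x v = G.adjMap x v + x v :=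
  rfl

theorem sum_mul_loopedMap_comm (x y : V → ZMod 2) :
    ∑ v, x v * G.loopedMap y v = ∑ v, y v * G.loopedMap x v := by
  simp only [loopedMap_apply, mul_add, Finset.sum_add_distrib]
  rw [sum_mul_adjMap_comm]
  simp only [mul_comm]

theorem sum_mul_loopedMap_self (x : V → ZMod 2) : ∑ v, x v * G.loopedMap x v = ∑ v, x v := by
  have h : ∀ z : ZMod 2, z * z = z := by decide
  simp only [loopedMap_apply, mul_add, Finset.sum_add_distrib, sum_mul_adjMap_self, zero_add, h]

/-- The diagonal of a symmetric matrix over the field with two elements lies in its range. -/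
theorem exists_loopedMap_eq_one (G : SimpleGraph V) : ∃ x, G.loopedMap x = 1 := by
  classical
  by_contra hn
  have hn' : (1 : V → ZMod 2) ∉ LinearMap.range G.loopedMap := hn
  obtain ⟨φ, hφ, hφ0⟩ := Submodule.exists_dual_map_eq_bot_of_notMem hn' inferInstance
  have hφr : ∀ z, φ (G.loopedMap z) = 0 := by
    intro z
    have : φ (G.loopedMap z) ∈ (LinearMap.range G.loopedMap).map φ :=
      ⟨_, ⟨z, rfl⟩, rfl⟩
    rwa [hφ0, Submodule.mem_bot] at this
  set y : V → ZMod 2 := fun v => φ (Pi.single v 1) with hy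
  have hdot : ∀ z, φ z = ∑ v, y v * z v := by
    intro z
    rw [LinearMap.pi_apply_eq_sum_univ φ z]
    refine Finset.sum_congr rfl fun v _ => ?_
    rw [smul_eq_mul, mul_comm, hy]
    congr 2
    ext w
    simp [Pi.single_apply, eq_comm]
  have hker : G.loopedMap y = 0 := by
    ext w
    have h := hφr (Pi.single w 1)
    rw [hdot, sum_mul_loopedMap_comm, Finset.sum_eq_single w] at h
    · simpa using h
    · intro v _ hv
      simp [hv]
    · simp
  apply hφ
  rw [hdot]
  have h := sum_mul_loopedMap_self (G := G) y
  rw [hker] at h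
  simpa using h.symm

theorem adjMap_compl (x : V → ZMod 2) (v : V) :
    Gᶜ.adjMap x v = G.loopedMap x v + ∑ w, x w := by
  classical
  have hbit : ∀ w, Gᶜ.adjBit v w = G.adjBit v w + (if v = w then 1 else 0) + 1 := by
    intro w
    have h2 : (1 + 1 : ZMod 2) = 0 := rfl
    by_cases hvw : v = w
    · subst hvw
      simp [adjBit_self, h2]
    · by_cases h : G.Adj v w <;> simp [adjBit, hvw, h, h2]
  rw [loopedMap_apply, adjMap_apply, adjMap_apply]
  simp only [hbit, add_mul, Finset.sum_add_distrib]
  simp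

theorem sum_loopedMap_mul {x : V → ZMod 2} (hx : G.loopedMap x = 1) (v : V → ZMod 2) :
    ∑ w, G.loopedMap v w * x w = ∑ w, v w := by
  have h := sum_mul_loopedMap_comm (G := G) v x
  rw [hx] at h
  simpa [mul_comm] using h.symm

theorem mem_inducedKernel_compl_univ {x : V → ZMod 2} (hx : G.loopedMap x = 1)
    (v : V → ZMod 2) : v ∈ Gᶜ.inducedKernel Finset.univ ↔
      v + (∑ w, v w) • x ∈ LinearMap.ker G.loopedMap := by
  rw [mem_inducedKernel, LinearMap.mem_ker, map_add, map_smul, hx, funext_iff]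
  simp [adjMap_compl]

/-- Writing `B = A + I`, `B x = 1` and `J` for the all-ones matrix, the adjacency matrix of the
complement is `B + J`, and `(B + J) v = B (v + (∑ w, v w) x)`. Whether `v ↦ v + (∑ w, v w) x`
is invertible is decided by the parity of the size of `x`. -/
theorem nullity_compl_univ {x : V → ZMod 2} (hx : G.loopedMap x = 1) :
    ((Gᶜ.nullity Finset.univ : ℕ) : ZMod 2) =
      (Module.finrank (ZMod 2) (LinearMap.ker G.loopedMap) : ℕ) + ∑ v, x v := by
  have hsum : ∀ (v : V → ZMod 2) (s : ZMod 2),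
      ∑ w, (v + s • x) w = ∑ w, v w + s * ∑ w, x w := by
    intro v s
    simp [Finset.sum_add_distrib, Finset.mul_sum]
  have h2 : ∀ v : V → ZMod 2, v + v = 0 := fun v => by
    ext w
    exact CharTwo.add_self_eq_zero _
  have h01 : ∀ z : ZMod 2, z = 0 ∨ z = 1 := by decide
  rcases h01 (∑ v, x v) with h | h
  · have e : Gᶜ.inducedKernel Finset.univ ≃ LinearMap.ker G.loopedMap :=
      { toFun := fun v => ⟨v.1 + (∑ w, v.1 w) • x, (mem_inducedKernel_compl_univ hx _).1 v.2⟩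
        invFun := fun v => ⟨v.1 + (∑ w, v.1 w) • x, (mem_inducedKernel_compl_univ hx _).2 (by
          rw [hsum, h, mul_zero, add_zero, add_assoc, h2, add_zero]
          exact v.2)⟩
        left_inv := fun v => Subtype.ext (by
          simp only [hsum, h, mul_zero, add_zero, add_assoc, h2])
        right_inv := fun v => Subtype.ext (by
          simp only [hsum, h, mul_zero, add_zero, add_assoc, h2]) }
    rw [nullity, finrank_eq_of_equiv e, h, add_zero]
  · have hker : ∀ v ∈ LinearMap.ker G.loopedMap, ∑ w, v w = 0 := by
      intro v hv
      rw [← sum_loopedMap_mul hx, LinearMap.mem_ker.1 hv]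
      simp
    have e : Gᶜ.inducedKernel Finset.univ ≃ LinearMap.ker G.loopedMap × ZMod 2 :=
      { toFun := fun v =>
          (⟨v.1 + (∑ w, v.1 w) • x, (mem_inducedKernel_compl_univ hx _).1 v.2⟩, ∑ w, v.1 w)
        invFun := fun p => ⟨p.1.1 + p.2 • x, (mem_inducedKernel_compl_univ hx _).2 (by
          rw [hsum, hker _ p.1.2, h, mul_one, zero_add, add_assoc, h2, add_zero]
          exact p.1.2)⟩
        left_inv := fun v => Subtype.ext (by simp only [add_assoc, h2, add_zero])
        right_inv := fun p => by
          ext1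
          · apply Subtype.ext
            simp only [hsum, hker _ p.1.2, h, mul_one, zero_add, add_assoc, h2, add_zero]
          · simp only [hsum, hker _ p.1.2, h, mul_one, zero_add] }
    have hcard : 2 ^ Gᶜ.nullity Finset.univ =
        2 ^ (Module.finrank (ZMod 2) (LinearMap.ker G.loopedMap) + 1) := by
      rw [nullity, ← natCard_eq_two_pow, Nat.card_congr e, Nat.card_prod, natCard_eq_two_pow,
        Nat.card_zmod, pow_succ]
    rw [Nat.pow_right_injective le_rfl hcard, h]
    push_cast
    rfl

open Classical in
/-- For a fixed vector `x`, the signed count of the sets `S` with `x ∈ ker A[S]` vanishes unless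
exactly one set `S` is possible, that is, unless `A x + x = 1`. -/
theorem sum_neg_one_pow_card_of_mem_inducedKernel (x : V → ZMod 2) :
    ∑ S : Finset V with x ∈ G.inducedKernel S, (-1 : ℤ) ^ S.card =
      if G.loopedMap x = 1 then (-1) ^ ({v | x v ≠ 0} : Finset V).card else 0 := by
  have h01 : ∀ z : ZMod 2, z = 0 ∨ z = 1 := by decide
  have h2 : (1 + 1 : ZMod 2) = 0 := rfl
  split_ifs with hx
  · have hx' : ∀ v, G.adjMap x v = 0 ↔ x v ≠ 0 := by
      intro v
      have h := congrFun hx v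
      rw [loopedMap_apply, Pi.one_apply] at h
      rcases h01 (G.adjMap x v) with h1 | h1 <;> rcases h01 (x v) with h3 | h3 <;>
        simp_all
    rw [Finset.sum_eq_single ({v | x v ≠ 0} : Finset V)]
    · intro S hS hne
      refine absurd ?_ hne
      obtain ⟨h1, h3⟩ := mem_inducedKernel.1 (Finset.mem_filter.1 hS).2
      ext v
      rw [Finset.mem_filter, and_iff_right (Finset.mem_univ v)]
      exact ⟨fun hv => (hx' v).1 (h3 v hv), fun hv => by_contra fun h => hv (h1 v h)⟩
    · intro h
      refine absurd (Finset.mem_filter.2 ⟨Finset.mem_univ ({v | x v ≠ 0} : Finset V),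
        mem_inducedKernel.2 ⟨?_, ?_⟩⟩) h
      · intro v hv
        simpa using hv
      · intro v hv
        exact (hx' v).2 (by simpa using hv)
  · obtain ⟨v, hv⟩ : ∃ v, G.adjMap x v + x v ≠ 1 := by
      by_contra hn
      push Not at hn
      exact hx (funext hn)
    rcases h01 (x v) with h3 | h3
    · -- the vertex `v` may be added to `S` or removed from it
      have h1 : G.adjMap x v = 0 := by
        rcases h01 (G.adjMap x v) with h1 | h1
        · exact h1
        · rw [h1, h3] at hv
          exact absurd rfl hv
      have hmem : ∀ S : Finset V,
          (x ∈ G.inducedKernel (insert v S) ↔ x ∈ G.inducedKernel (S.erase v)) := by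
        intro S
        simp only [mem_inducedKernel, Finset.mem_insert, Finset.mem_erase]
        constructor
        · rintro ⟨h4, h5⟩
          refine ⟨fun w hw => ?_, fun w hw => h5 w (Or.inr hw.2)⟩
          by_cases hwv : w = v
          · rw [hwv, h3]
          · exact h4 w (by tauto)
        · rintro ⟨h4, h5⟩
          refine ⟨fun w hw => h4 w (by tauto), fun w hw => ?_⟩
          by_cases hwv : w = v
          · rw [hwv, h1]
          · exact h5 w (by tauto)
      refine Finset.sum_involution
        (fun S _ => if v ∈ S then S.erase v else insert v S) ?_ ?_ ?_ ?_
      · intro S _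
        by_cases hvS : v ∈ S
        · rw [if_pos hvS, ← Finset.card_erase_add_one hvS, pow_succ]
          ring
        · rw [if_neg hvS, Finset.card_insert_of_notMem hvS, pow_succ]
          ring
      · intro S _ _ h
        by_cases hvS : v ∈ S
        · rw [if_pos hvS] at h
          rw [← h] at hvS
          simp at hvS
        · rw [if_neg hvS] at h
          rw [← h] at hvS
          simp at hvS
      · intro S hS
        rw [Finset.mem_filter] at hS ⊢
        refine ⟨Finset.mem_univ _, ?_⟩
        by_cases hvS : v ∈ S
        · rw [if_pos hvS, ← hmem, Finset.insert_eq_of_mem hvS]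
          exact hS.2
        · rw [if_neg hvS, hmem, Finset.erase_eq_of_notMem hvS]
          exact hS.2
      · intro S _
        by_cases hvS : v ∈ S
        · simp [hvS, Finset.insert_erase]
        · simp [hvS]
    · -- no set `S` is possible
      have h1 : G.adjMap x v ≠ 0 := fun h1 => by
        rw [h1, h3] at hv
        exact hv rfl
      rw [Finset.sum_eq_zero]
      intro S hS
      obtain ⟨h4, h5⟩ := mem_inducedKernel.1 (Finset.mem_filter.1 hS).2
      by_cases hvS : v ∈ S
      · exact absurd (h5 v hvS) h1
      · rw [h4 v hvS] at h3
        exact absurd h3 (by decide)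

theorem neg_one_pow_card_support {x : V → ZMod 2} (hx : G.loopedMap x = 1) [DecidableEq V] :
    (-1 : ℤ) ^ ({v | x v ≠ 0} : Finset V).card =
      (-1) ^ (Fintype.card V + Module.finrank (ZMod 2) (LinearMap.ker G.loopedMap)) := by
  have hsupp : ((({v | x v ≠ 0} : Finset V).card : ℕ) : ZMod 2) = ∑ v, x v := by
    have h : ∀ z : ZMod 2, (if z ≠ 0 then 1 else 0) = z := by decide
    rw [Finset.card_filter]
    push_cast
    exact Finset.sum_congr rfl fun v _ => h (x v)
  have heven := even_nullity_add_card Gᶜ Finset.univ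
  rw [← ZMod.natCast_eq_zero_iff_even, Nat.cast_add, nullity_compl_univ hx, ← hsupp,
    ← Nat.cast_add, ← Nat.cast_add, ZMod.natCast_eq_zero_iff_even, Finset.card_univ] at heven
  have h1 : ∀ m n : ℕ, Even (m + n) → (-1 : ℤ) ^ m = (-1) ^ n := by
    intro m n h
    rcases Nat.even_or_odd m with hm | hm
    · rw [hm.neg_one_pow, ((Nat.even_add.1 h).1 hm).neg_one_pow]
    · have hn : Odd n := Nat.not_even_iff_odd.1 fun hn =>
        Nat.not_even_iff_odd.2 hm ((Nat.even_add.1 h).2 hn)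
      rw [hm.neg_one_pow, hn.neg_one_pow]
  apply h1
  convert heven using 1
  ring

theorem eval_nullityPoly_neg_one (G : SimpleGraph V) :
    G.nullityPoly.eval (-1) =
      (-1) ^ Nat.card V * (-2) ^ Module.finrank (ZMod 2) (LinearMap.ker G.loopedMap) := by
  classical
  have hterm : ∀ S : Finset V, ((-2 : ℤ)) ^ G.nullity S =
      ∑ x : V → ZMod 2 with x ∈ G.inducedKernel S, (-1 : ℤ) ^ S.card := by
    intro S
    have hcard : ({x : V → ZMod 2 | x ∈ G.inducedKernel S} : Finset _).card =
        2 ^ G.nullity S := by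
      rw [nullity, ← natCard_eq_two_pow, ← Fintype.card_subtype, ← Nat.card_eq_fintype_card]
    have hpow : (-1 : ℤ) ^ S.card = (-1) ^ G.nullity S := by
      rcases Nat.even_or_odd S.card with h | h
      · rw [h.neg_one_pow, ((Nat.even_add.1 (G.even_nullity_add_card S)).2 h).neg_one_pow]
      · have h' : Odd (G.nullity S) := Nat.not_even_iff_odd.1 fun h' =>
          Nat.not_even_iff_odd.2 h ((Nat.even_add.1 (G.even_nullity_add_card S)).1 h')
        rw [h.neg_one_pow, h'.neg_one_pow]
    rw [Finset.sum_const, hcard, hpow, nsmul_eq_mul]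
    push_cast
    rw [← mul_pow]
    norm_num
  obtain ⟨x₀, hx₀⟩ := G.exists_loopedMap_eq_one
  have hsol : ({x : V → ZMod 2 | G.loopedMap x = 1} : Finset _).card =
      2 ^ Module.finrank (ZMod 2) (LinearMap.ker G.loopedMap) := by
    rw [← natCard_eq_two_pow, ← Fintype.card_subtype, ← Nat.card_eq_fintype_card]
    exact Nat.card_congr ((Equiv.subRight x₀).subtypeEquiv fun x => by
      simp [hx₀, sub_eq_zero])
  have hswap : ∑ S : Finset V, ∑ x : V → ZMod 2 with x ∈ G.inducedKernel S, (-1 : ℤ) ^ S.card =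
      ∑ x : V → ZMod 2, ∑ S : Finset V with x ∈ G.inducedKernel S, (-1 : ℤ) ^ S.card := by
    apply Finset.sum_comm'
    simp
  rw [nullityPoly, eval_finsetSum]
  simp only [eval_pow, eval_sub, eval_X, eval_one]
  rw [show (-1 - 1 : ℤ) = -2 by norm_num, Finset.sum_congr rfl fun S _ => hterm S, hswap,
    Finset.sum_congr rfl fun x _ => sum_neg_one_pow_card_of_mem_inducedKernel x,
    ← Finset.sum_filter, Finset.sum_congr rfl fun x hx =>
      neg_one_pow_card_support (Finset.mem_filter.1 hx).2, Finset.sum_const, hsol, nsmul_eq_mul,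
    Nat.card_eq_fintype_card, pow_add, mul_left_comm, show (-2 : ℤ) = 2 * -1 by norm_num, mul_pow]
  push_cast
  rfl

end SimpleGraph

theorem corollary27 {V E : Type*} [Finite V] [Finite E] (D : MultiDigraph V E)
    (hD : D.TwoInTwoOut) :
    -- Martin's theorem, with `a(D)` the size of the unique decomposition into anti-circuits
    (∃ P : Set (Set E), D.IsAntiCircuitDecomposition P ∧
      (∀ Q : Set (Set E), D.IsAntiCircuitDecomposition Q → Q = P) ∧
      -2 * D.martin.eval (RingHom.id ℚ) (-1) = ((D.circuitPartitionPoly.eval (-2) : ℤ) : ℚ) ∧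
      D.circuitPartitionPoly.eval (-2) = (-1) ^ (Nat.card V + P.ncard) * 2 ^ P.ncard) ∧
    -- the interlace polynomial of an interlace graph at `-1`
    (∀ c : Cycle E, D.IsEulerCircuit c →
      ∃ q : ℤ[X], IsInterlacePolynomial (D.interlaceGraph c) q ∧
        (∀ q' : ℤ[X], IsInterlacePolynomial (D.interlaceGraph c) q' → q' = q) ∧
        ∃ k : ℕ, q.eval (-1) = (-1) ^ Nat.card V * (-2) ^ k) := by
  constructor
  · obtain ⟨i, hi⟩ := Equiv.Perm.exists_isFibreSwap fun v => (hD v).1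
    obtain ⟨o, ho⟩ := Equiv.Perm.exists_isFibreSwap fun v => (hD v).2
    obtain ⟨f, hf⟩ := Equiv.Perm.exists_alternates hi.toIsFreeInvolution ho.toIsFreeInvolution
    have hsrc : Function.Surjective D.src := fun v =>
      Set.nonempty_of_ncard_ne_zero (s := {e | D.src e = v}) (by rw [(hD v).2]; norm_num)
    have hr := MultiDigraph.setOf_isAntiCircuit hi ho hf
    refine ⟨_, ⟨Setoid.isPartition_classes _, fun S hS => ?_⟩,
      fun Q hQ => MultiDigraph.eq_of_isAntiCircuitDecomposition hr hQ,
      D.neg_two_mul_eval_martin, ?_⟩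
    · rw [← hr] at hS
      exact hS
    · rw [MultiDigraph.ncard_classes_sameCycle]
      exact MultiDigraph.eval_circuitPartitionPoly_neg_two
        (Equiv.Perm.card_eq_two_mul_of_fibres fun v => (hD v).1) hi ho hsrc hf
  · intro c _
    cases nonempty_fintype V
    obtain ⟨q, hq⟩ := exists_isInterlacePolynomial (D.interlaceGraph c)
    exact ⟨q, hq, fun q' hq' => hq'.eq_nullityPoly.trans hq.eq_nullityPoly.symm, _,
      hq.eq_nullityPoly ▸ SimpleGraph.eval_nullityPoly_neg_one _⟩
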